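/- **Setting.** Let $d\ge 1$, $k\ge 0$ and $L_1,\dots,L_d\ge 1$. Consider the periodic lattice (discrete torus) with $L_1\times\cdots\times L_d$ unit cells and $k$ fermion modes $c_{i,\alpha}$ ($1\le\alpha\le k$) in each cell $i$, acting on the fermionic Fock space with vacuum $|\mathbf 0\rangle$. For a direction $x$, the translation operator $T_x$ is the unitary determined by $T_x c_{i,\alpha}T_x^{-1}=c_{i+\hat x,\alpha}$ (periodic boundary conditions) and $T_x|\mathbf 0\rangle=|\mathbf 0\rangle$. A *product state* is an unentangled product over the unit cells of single-cell states, each of definite fermion parity (the single-cell states may differ from cell to cell). A *gate* on a set $S$ of cells is a unitary that preserves the fermion parity $(-1)^N$ and lies in the algebra generated by the fermion operators of the cells in $S$; it has range at most $r$ if any two cells of $S$ are at distance at most $r$ in each coordinate direction of the torus. A *circuit* of depth $D$ and range $r$ is a product of $D$ layers, each a product of gates of range at most $r$ with pairwise disjoint supports. A nonzero state $|\Psi\rangle$ is *short-range entangled* with depth $D$ and range $r$ if some circuit of depth $D$ and range $r$ maps it to a product state; otherwise it is *long-range entangled* with respect to $D$ and $r$. **Theorem 2.** There is a universal constant $C$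 (independent of $d$, $k$, the system size, $r$, $D$ and the state) such that the following holds for every direction $x$ and all $r,D\ge 0$ with $L_x\ge C\,rD$. Let $|\Psi\rangle\neq 0$ satisfy $T_x|\Psi\rangle=e^{iP_x}|\Psi\rangle$. 1. If $|\Psi\rangle$ is short-range entangled with depth $D$ and range $r$, then $e^{iP_x}=1$ if $L_x$ is odd, and $e^{iP_x}=\pm1$ if $L_x$ is even. States violating this condition must in turn be long-range entangled with respect to $D$ and $r$. 2. If $L_x$ is even and $|\Psi\rangle$ has odd total fermion parity, $(-1)^N|\Psi\rangle=-|\Psi\rangle$, then $|\Psi\rangle$ is long-range entangled with respect to $D$ and $r$. -/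

import Mathlib

open scoped Matrix

noncomputable section

namespace LatticeFermion

/-! ### Fermionic Fock space over a finite linearly ordered set of modes -/

section Fock

variable {ι : Type} [LinearOrder ι] [Fintype ι]

/-- Operators on the fermionic Fock space with set of modes `ι`, as matrices in the orthonormal
occupation number basis. The basis vector `|s⟩` of `s = {i₁ < ⋯ < iₚ}` is
`c†_{i₁} ⋯ c†_{iₚ} |0⟩`. -/
abbrev Op (ι : Type) : Type := Matrix (Finset ι) (Finset ι) ℂ

/-- (Unnormalised) state vectors in the Fock space. -/
abbrev State (ι : Type) : Type := Finset ι → ℂ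

/-- The annihilation operator `c_i`:
`c_i |s⟩ = (-1)^{#{j ∈ s : j < i}} |s \ {i}⟩` if `i ∈ s`, and `c_i |s⟩ = 0` otherwise. -/
def annihilate (i : ι) : Op ι :=
  Matrix.of fun t s => if i ∈ s ∧ t = s.erase i then (-1) ^ (s.filter (· < i)).card else 0

/-- The fermion vacuum. -/
def vacuum : State ι := Pi.single ∅ 1

/-- The total fermion parity `(-1)^N`. -/
def parity : Op ι := Matrix.diagonal fun s => (-1) ^ s.card

/-- The operator on Fock space implementing the permutation `σ` of the modes:
`c†_{i₁} ⋯ c†_{iₚ} |0⟩ ↦ c†_{σ i₁} ⋯ c†_{σ iₚ} |0⟩`. Reordering the right side into increasing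
order gives the sign of the number of inversions of `σ` on the occupied modes. -/
def permOp (σ : Equiv.Perm ι) : Op ι :=
  Matrix.of fun t s =>
    if t = s.map σ.toEmbedding then
      (-1) ^ ((s ×ˢ s).filter fun p => p.1 < p.2 ∧ σ p.2 < σ p.1).card
    else 0

/-- Permutations of the modes fix the vacuum. -/
theorem permOp_mulVec_vacuum (σ : Equiv.Perm ι) : permOp σ *ᵥ (vacuum : State ι) = vacuum := by
  ext t
  by_cases h : t = ∅ <;> simp [vacuum, permOp, h]

/-- `T c_i = c_{σ i} T`; with the previous fact this determines the operator. -/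
theorem permOp_mul_annihilate (σ : Equiv.Perm ι) (i : ι) :
    permOp σ * annihilate i = annihilate (σ i) * permOp σ := by
  ext t s
  have hL : (permOp σ * annihilate i) t s =
      if i ∈ s then permOp σ t (s.erase i) * (-1) ^ (s.filter (· < i)).card else 0 := by
    by_cases hi : i ∈ s <;> simp [Matrix.mul_apply, annihilate, hi]
  have hR : (annihilate (σ i) * permOp σ) t s =
      annihilate (σ i) t (s.map σ.toEmbedding) * permOp σ (s.map σ.toEmbedding) s := by
    simp only [Matrix.mul_apply]
    refine Finset.sum_eq_single _ (fun b _ hb => ?_) (by simp)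
    simp [permOp, hb]
  rw [hL, hR]
  by_cases hi : i ∈ s
  swap
  · simp [annihilate, hi]
  have he : (s.erase i).map σ.toEmbedding = (s.map σ.toEmbedding).erase (σ i) := by
    ext j; simp [Finset.mem_erase]
  by_cases ht : t = (s.map σ.toEmbedding).erase (σ i)
  swap
  · simp [annihilate, permOp, he, ht]
  simp only [annihilate, permOp, Matrix.of_apply, he, ht, hi, if_true, Finset.mem_map_equiv,
    Equiv.symm_apply_apply, and_self, ← pow_add]
  -- counting of inversions involving `i`
  have h1 : ((s ×ˢ s).filter fun p => p.1 < p.2 ∧ σ p.2 < σ p.1).card =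
      (((s.erase i) ×ˢ (s.erase i)).filter fun p => p.1 < p.2 ∧ σ p.2 < σ p.1).card +
      ((s.filter fun j => j < i ∧ σ i < σ j).card + (s.filter fun j => i < j ∧ σ j < σ i).card) := by
    have e : (s ×ˢ s).filter (fun p => p.1 < p.2 ∧ σ p.2 < σ p.1) =
        (((s.erase i) ×ˢ (s.erase i)).filter fun p => p.1 < p.2 ∧ σ p.2 < σ p.1) ∪
        (((s.filter fun j => j < i ∧ σ i < σ j).image fun j => (j, i)) ∪
         ((s.filter fun j => i < j ∧ σ j < σ i).image fun j => (i, j))) := by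
      ext ⟨a, b⟩
      simp only [Finset.mem_filter, Finset.mem_product, Finset.mem_union, Finset.mem_erase,
        Finset.mem_image, Prod.mk.injEq]
      constructor
      · rintro ⟨⟨ha, hb⟩, h, h'⟩
        by_cases hai : a = i
        · subst hai; exact Or.inr (Or.inr ⟨b, ⟨hb, h, h'⟩, rfl, rfl⟩)
        by_cases hbi : b = i
        · subst hbi; exact Or.inr (Or.inl ⟨a, ⟨ha, h, h'⟩, rfl, rfl⟩)
        exact Or.inl ⟨⟨⟨hai, ha⟩, hbi, hb⟩, h, h'⟩
      · rintro (⟨⟨⟨_, ha⟩, _, hb⟩, h⟩ | ⟨j, ⟨hj, h⟩, rfl, rfl⟩ | ⟨j, ⟨hj, h⟩, rfl, rfl⟩)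
        exacts [⟨⟨ha, hb⟩, h⟩, ⟨⟨hj, hi⟩, h⟩, ⟨⟨hi, hj⟩, h⟩]
    rw [e, Finset.card_union_of_disjoint, Finset.card_union_of_disjoint,
      Finset.card_image_of_injective _ (fun _ _ h => by simpa using h),
      Finset.card_image_of_injective _ (fun _ _ h => by simpa using h)]
    · rw [Finset.disjoint_left]; rintro ⟨a, b⟩; simp; grind
    · rw [Finset.disjoint_left]; rintro ⟨a, b⟩; simp; grind
  have h2 : (s.filter (· < i)).card = (s.filter fun j => j < i ∧ σ j < σ i).card +
      (s.filter fun j => j < i ∧ σ i < σ j).card := by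
    rw [← Finset.card_union_of_disjoint]
    · congr 1; ext j
      have := σ.injective.ne (a₁ := j) (a₂ := i)
      simp only [Finset.mem_filter, Finset.mem_union]; grind
    · rw [Finset.disjoint_left]; simp; grind
  have h3 : ((s.map σ.toEmbedding).filter (· < σ i)).card =
      (s.filter fun j => j < i ∧ σ j < σ i).card + (s.filter fun j => i < j ∧ σ j < σ i).card := by
    rw [Finset.filter_map, Finset.card_map, ← Finset.card_union_of_disjoint]
    · congr 1; ext j
      simp only [Finset.mem_filter, Finset.mem_union, Function.comp, Equiv.coe_toEmbedding]; grind
    · rw [Finset.disjoint_left]; simp; grind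
  rw [h1, h2, h3]
  apply neg_one_pow_congr
  simp only [Nat.even_add]; tauto

/-- The algebra generated by the fermion operators of a set `M` of modes. -/
def modeAlgebra (M : Set ι) : Subalgebra ℂ (Op ι) :=
  Algebra.adjoin ℂ {a | ∃ i ∈ M, a = annihilate i ∨ a = (annihilate i)ᴴ}

end Fock

/-! ### The lattice: unit cells of a `d`-dimensional discrete torus, `k` modes per cell -/

section Lattice

variable {d : ℕ}

/-- Unit cells of the periodic lattice of size `L 0 × ⋯ × L (d - 1)`. -/
abbrev Cell (L : Fin d → ℕ) : Type := (j : Fin d) → Fin (L j)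

/-- The fermion modes: a unit cell and an internal index. They are ordered lexicographically,
so that the modes of one unit cell are consecutive. -/
abbrev Mode (L : Fin d → ℕ) (k : ℕ) : Type := Lex (Lex (Cell L) × Fin k)

variable {L : Fin d → ℕ} {k : ℕ}

/-- The mode with internal index `α` in the unit cell `i`. -/
def Mode.mk (i : Cell L) (α : Fin k) : Mode L k := toLex (toLex i, α)

/-- The unit cell of a mode. -/
def Mode.cell (m : Mode L k) : Cell L := ofLex (ofLex m).1

/-- The internal index of a mode. -/
def Mode.flavor (m : Mode L k) : Fin k := (ofLex m).2

/-- Distance of two points on the ring with `n` sites. -/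
def ringDist {n : ℕ} (a b : Fin n) : ℕ := min (a - b).val (b - a).val

/-- The permutation `(i, α) ↦ (i + e_x, α)` of the modes. -/
def shift [∀ j, NeZero (L j)] (x : Fin d) : Equiv.Perm (Mode L k) where
  toFun m := Mode.mk (m.cell + Pi.single x 1) m.flavor
  invFun m := Mode.mk (m.cell - Pi.single x 1) m.flavor
  left_inv m := by simp [Mode.mk, Mode.cell, Mode.flavor]
  right_inv m := by simp [Mode.mk, Mode.cell, Mode.flavor]

/-- Lattice translation by one unit cell in direction `x`, with periodic boundary conditions. -/
def translation (L : Fin d → ℕ) [∀ j, NeZero (L j)] (k : ℕ) (x : Fin d) : Op (Mode L k) :=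
  permOp (shift x)

/-- `φ` is an unentangled product state over the unit cells, with definite fermion parity in each
unit cell. Here `g i` is the state of the cell `i` in its occupation number basis. The modes of a
cell being consecutive, `φ` is `∏_i f_i |0⟩`, the product in increasing order of the cells, with
`f_i = ∑_A g_i(A) ∏_{α ∈ A} c†_{i,α}`. -/
def IsProductState (φ : State (Mode L k)) : Prop :=
  ∃ g : Cell L → Finset (Fin k) → ℂ,
    (∀ i, (∀ A, g i A ≠ 0 → Even A.card) ∨ (∀ A, g i A ≠ 0 → Odd A.card)) ∧
    ∀ s, φ s = ∏ i : Cell L, g i (Finset.univ.filter fun α => Mode.mk i α ∈ s)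

/-- `u` is a fermionic gate on the set `S` of unit cells: a fermion parity preserving unitary in
the algebra generated by the fermion operators of the cells in `S`. -/
def IsGate (S : Finset (Cell L)) (u : Op (Mode L k)) : Prop :=
  u ∈ modeAlgebra {m : Mode L k | m.cell ∈ S} ∧ u ∈ Matrix.unitaryGroup (Finset (Mode L k)) ℂ ∧
    Commute u parity

/-- A set of cells has range at most `r`: any two of its cells are at distance at most `r` in each
coordinate direction of the torus. -/
def HasRange (r : ℕ) (S : Finset (Cell L)) : Prop :=
  ∀ a ∈ S, ∀ b ∈ S, ∀ j, ringDist (a j) (b j) ≤ r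

/-- One layer of a circuit: a product of gates of range at most `r` with pairwise disjoint
supports. -/
def IsLayer (r : ℕ) (A : Op (Mode L k)) : Prop :=
  ∃ (n : ℕ) (S : Fin n → Finset (Cell L)) (u : Fin n → Op (Mode L k)),
    (∀ a, HasRange r (S a) ∧ IsGate (S a) (u a)) ∧ Pairwise (fun a b => Disjoint (S a) (S b)) ∧
    A = (List.ofFn u).prod

/-- A fermion parity preserving quantum circuit of depth `D` with gates of range at most `r`. -/
def IsCircuit (r D : ℕ) (U : Op (Mode L k)) : Prop :=
  ∃ l : List (Op (Mode L k)), l.length = D ∧ (∀ A ∈ l, IsLayer r A) ∧ U = l.prod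

/-- `Ψ` is taken to a product state by a parity preserving circuit of depth `D` with gates of
range at most `r`. -/
def IsShortRangeEntangled (r D : ℕ) (Ψ : State (Mode L k)) : Prop :=
  ∃ U : Op (Mode L k), IsCircuit r D U ∧ IsProductState (U *ᵥ Ψ)

/-- Long-range entangled (at range `r` and depth `D`) means not short-range entangled. -/
def IsLongRangeEntangled (r D : ℕ) (Ψ : State (Mode L k)) : Prop :=
  ¬ IsShortRangeEntangled r D Ψ

end Lattice

end LatticeFermion

end

open scoped Matrix

noncomputable section

set_option linter.unusedSectionVars false
set_option linter.unusedVariables false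

/-! Only the direction `x` matters: the torus is a ring of `n` columns, and translation is the mode
permutation induced by the rotation of this ring. If a circuit takes Ψ to a product state, deleting
its gates across a cut costs a unitary supported within `r * D` columns of the cut
(`IsCircuitOn.cut_strip`), so Ψ can be disentangled across chosen cuts by local even unitaries
(`exists_cuts`). Absence of entanglement is expressed by an even minimal projection in the algebra
of a region (`IsPureOn`), so no tensor factorisation of Fock space is needed. Overlapping pure
regions have a pure union (`IsPureOn.union_of_overlap`), hence cuts from Ψ and from its translates
can be combined (`IsPureOn.mix`).

Momentum: let a + b = n. A block cut out of Ψ and its translate by a are in the same state, so their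
exchange acts as a sign (`ColumnAction.exists_sign`). On Ψ itself the exchange is therefore, up to
sign, a product of two local gluings, one for each end of the block. Compare the blocks [q, c) and
[q + 1, c), using the same unitary at c and translated unitaries at the left ends. The gluings at c
cancel, and the left gluing M satisfies τ T M Ψ = ± z M Ψ, where τ exchanges the columns q and q +
a. The permutation τ ∘ `rot` has two cycles, of lengths a and b: M Ψ lives on two separate rings.
Hence z^(2ab) = 1 (`ColumnAction.pow_eq_one_of_pure`). Together with z^n = 1, a choice of a and b
close to n / 2 forces z = 1 for odd n and z² = 1 for even n.

Parity: for n = 2a, a local unitary and its translate by a cut the ring into two halves exchanged by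
T^a. The halves have equal parity, so the total parity is even (`ColumnAction.parity_of_circuit`).
-/

namespace LatticeFermion

/-! ### Canonical anticommutation relations and the algebras of sets of modes. -/

section FockAlgebra

variable {ι : Type} [LinearOrder ι] [Fintype ι]

/-- The sign `(-1)^{#{j ∈ s : j < i}}` in the definition of the fermion operators. -/
def jwSign (i : ι) (s : Finset ι) : ℂ := (-1) ^ (s.filter (· < i)).card

theorem jwSign_mul_self (i : ι) (s : Finset ι) : jwSign i s * jwSign i s = 1 := by
  rw [jwSign, ← mul_pow]; simp

theorem jwSign_insert {i j : ι} {s : Finset ι} (h : j ∉ s) :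
    jwSign i (insert j s) = (if j < i then -1 else 1) * jwSign i s := by
  unfold jwSign
  rw [Finset.filter_insert]
  split_ifs with hj
  · rw [Finset.card_insert_of_notMem (by simp [h]), pow_succ]; ring
  · simp

theorem jwSign_erase {i j : ι} {s : Finset ι} (h : j ∈ s) :
    jwSign i (s.erase j) = (if j < i then -1 else 1) * jwSign i s := by
  conv_rhs => rw [← Finset.insert_erase h, jwSign_insert (Finset.notMem_erase j s)]
  split_ifs <;> simp

theorem annihilate_mulVec (i : ι) (ψ : State ι) (t : Finset ι) :
    (annihilate i *ᵥ ψ) t = if i ∈ t then 0 else jwSign i t * ψ (insert i t) := by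
  simp only [Matrix.mulVec, dotProduct, annihilate, Matrix.of_apply]
  split_ifs with h
  · refine Finset.sum_eq_zero fun s _ => ?_
    rw [if_neg, zero_mul]
    rintro ⟨_, rfl⟩
    simp at h
  · rw [Finset.sum_eq_single (insert i t)]
    · rw [if_pos (by simp [h])]
      congr 1
      rw [jwSign, Finset.filter_insert]; simp
    · intro s _ hs
      rw [if_neg, zero_mul]
      rintro ⟨h1, rfl⟩
      exact hs (by simp [h1])
    · simp

theorem create_mulVec (i : ι) (ψ : State ι) (s : Finset ι) :
    ((annihilate i)ᴴ *ᵥ ψ) s = if i ∈ s then jwSign i s * ψ (s.erase i) else 0 := by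
  simp only [Matrix.mulVec, dotProduct, annihilate, Matrix.of_apply, Matrix.conjTranspose_apply]
  split_ifs with h
  · rw [Finset.sum_eq_single (s.erase i)]
    · simp [h, jwSign]
    · intro t _ ht
      simp [ht]
    · simp
  · simp [h]

theorem op_ext {X Y : Op ι} (h : ∀ ψ : State ι, X *ᵥ ψ = Y *ᵥ ψ) : X = Y := by
  apply Matrix.toLin'.injective
  ext1 s
  ext1
  simp [h]

/-- Exactly one of i < j and j < i holds, so exactly one of the two orders of filling picks up an
extra sign. This is the source of all anticommutation relations below. -/
theorem jwSign_comm {i j : ι} (hij : i ≠ j) {s : Finset ι} (hi : i ∉ s) (hj : j ∉ s) :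
    jwSign i s * jwSign j (insert i s) = -(jwSign j s * jwSign i (insert j s)) := by
  rw [jwSign_insert hi, jwSign_insert hj]
  rcases lt_or_gt_of_ne hij with h | h
  · simp [h, h.not_gt]; ring
  · simp [h, h.not_gt]; ring

theorem annihilate_anticomm (i j : ι) :
    annihilate i * annihilate j = -(annihilate j * annihilate i) := by
  apply op_ext; intro ψ; ext t
  rw [Matrix.neg_mulVec, ← Matrix.mulVec_mulVec, ← Matrix.mulVec_mulVec]
  simp only [Pi.neg_apply, annihilate_mulVec, Finset.mem_insert]
  by_cases hij : i = j
  · subst hij; simp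
  by_cases hi : i ∈ t
  · simp [hi]
  by_cases hj : j ∈ t
  · simp [hj]
  simp only [hi, hj, hij, Ne.symm hij, or_self, if_false]
  rw [← mul_assoc, ← mul_assoc, jwSign_comm hij hi hj, Finset.insert_comm]; ring

theorem annihilate_create_anticomm {i j : ι} (hij : i ≠ j) :
    annihilate i * (annihilate j)ᴴ = -((annihilate j)ᴴ * annihilate i) := by
  apply op_ext; intro ψ; ext t
  rw [Matrix.neg_mulVec, ← Matrix.mulVec_mulVec, ← Matrix.mulVec_mulVec]
  simp only [Pi.neg_apply, annihilate_mulVec, create_mulVec, Finset.mem_insert, Finset.mem_erase]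
  by_cases hi : i ∈ t
  · simp [hi, hij]
  by_cases hj : j ∈ t
  · simp only [hi, hj, Ne.symm hij, if_false, if_true, or_true, and_false]
    rw [jwSign_insert hi, jwSign_erase hj, Finset.erase_insert_of_ne hij]
    rcases lt_or_gt_of_ne hij with h | h
    · simp [h, h.not_gt]; ring
    · simp [h, h.not_gt]; ring
  · simp [hj, Ne.symm hij]

theorem annihilate_create_self (i : ι) :
    annihilate i * (annihilate i)ᴴ + (annihilate i)ᴴ * annihilate i = 1 := by
  apply op_ext; intro ψ; ext t
  rw [Matrix.add_mulVec, ← Matrix.mulVec_mulVec, ← Matrix.mulVec_mulVec]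
  simp only [Pi.add_apply, annihilate_mulVec, create_mulVec, Matrix.one_mulVec]
  by_cases hi : i ∈ t
  · simp only [hi, if_true, Finset.notMem_erase, if_false, Finset.insert_erase, zero_add]
    rw [jwSign_erase hi, if_neg (lt_irrefl i), one_mul, ← mul_assoc, jwSign_mul_self, one_mul]
  · simp only [hi, if_true, if_false, Finset.mem_insert_self, Finset.erase_insert,
      not_false_eq_true, add_zero]
    rw [jwSign_insert hi, if_neg (lt_irrefl i), one_mul, ← mul_assoc, jwSign_mul_self, one_mul]

theorem create_anticomm (i j : ι) :
    (annihilate i)ᴴ * (annihilate j)ᴴ = -((annihilate j)ᴴ * (annihilate i)ᴴ) := by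
  rw [← Matrix.conjTranspose_mul, ← Matrix.conjTranspose_mul, annihilate_anticomm,
    Matrix.conjTranspose_neg]

theorem annihilate_sq (i : ι) : annihilate i * annihilate i = 0 := by
  have h := annihilate_anticomm i i
  ext s t
  have := congrFun (congrFun h s) t
  rw [Matrix.neg_apply] at this
  exact self_eq_neg.mp this

theorem create_sq (i : ι) : (annihilate i)ᴴ * (annihilate i)ᴴ = 0 := by
  rw [← Matrix.conjTranspose_mul, annihilate_sq, Matrix.conjTranspose_zero]

theorem parity_conjTranspose : (parity : Op ι)ᴴ = parity := by
  simp [parity, Matrix.diagonal_conjTranspose]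

theorem parity_sq : (parity : Op ι) * parity = 1 := by
  simp [parity, Matrix.diagonal_mul_diagonal, ← mul_pow]

theorem parity_mulVec (ψ : State ι) (s : Finset ι) : (parity *ᵥ ψ) s = (-1) ^ s.card * ψ s := by
  simp [parity, Matrix.mulVec_diagonal]

theorem parity_mul_annihilate (i : ι) : parity * annihilate i = -(annihilate i * parity) := by
  apply op_ext; intro ψ; ext t
  rw [Matrix.neg_mulVec, ← Matrix.mulVec_mulVec, ← Matrix.mulVec_mulVec]
  simp only [Pi.neg_apply, annihilate_mulVec, parity_mulVec]
  split_ifs with h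
  · simp
  · rw [Finset.card_insert_of_notMem h, pow_succ]; ring

theorem parity_mul_create (i : ι) : parity * (annihilate i)ᴴ = -((annihilate i)ᴴ * parity) := by
  have := congrArg Matrix.conjTranspose (parity_mul_annihilate i)
  rw [Matrix.conjTranspose_mul, Matrix.conjTranspose_neg, Matrix.conjTranspose_mul,
    parity_conjTranspose] at this
  rw [this, neg_neg]

theorem parity_conj_annihilate (i : ι) : parity * annihilate i * parity = -annihilate i := by
  rw [parity_mul_annihilate, neg_mul, mul_assoc, parity_sq, mul_one]

theorem parity_conj_create (i : ι) : parity * (annihilate i)ᴴ * parity = -(annihilate i)ᴴ := by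
  rw [parity_mul_create, neg_mul, mul_assoc, parity_sq, mul_one]

/-! ### The algebras of sets of modes -/

theorem annihilate_mem {M : Set ι} {i : ι} (h : i ∈ M) : annihilate i ∈ modeAlgebra M :=
  Algebra.subset_adjoin ⟨i, h, Or.inl rfl⟩

theorem create_mem {M : Set ι} {i : ι} (h : i ∈ M) : (annihilate i)ᴴ ∈ modeAlgebra M :=
  Algebra.subset_adjoin ⟨i, h, Or.inr rfl⟩

theorem modeAlgebra_mono {M M' : Set ι} (h : M ⊆ M') : modeAlgebra M ≤ modeAlgebra M' := by
  apply Algebra.adjoin_mono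
  rintro a ⟨i, hi, ha⟩
  exact ⟨i, h hi, ha⟩

theorem modeAlgebra_induction {M : Set ι} {p : (x : Op ι) → x ∈ modeAlgebra M → Prop}
    (ann : ∀ i (hi : i ∈ M), p (annihilate i) (annihilate_mem hi))
    (cre : ∀ i (hi : i ∈ M), p (annihilate i)ᴴ (create_mem hi))
    (scalar : ∀ c : ℂ, p (c • 1) (Subalgebra.smul_mem _ (one_mem _) c))
    (add : ∀ x y hx hy, p x hx → p y hy → p (x + y) (add_mem hx hy))
    (mul : ∀ x y hx hy, p x hx → p y hy → p (x * y) (mul_mem hx hy))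
    {x : Op ι} (hx : x ∈ modeAlgebra M) : p x hx := by
  unfold modeAlgebra at hx
  induction hx using Algebra.adjoin_induction with
  | mem x hx =>
    obtain ⟨i, hi, rfl | rfl⟩ := hx
    exacts [ann i hi, cre i hi]
  | algebraMap c => simp only [Algebra.algebraMap_eq_smul_one]; exact scalar c
  | add x y hx' hy' hx hy => exact add x y hx' hy' hx hy
  | mul x y hx' hy' hx hy => exact mul x y hx' hy' hx hy

theorem conjTranspose_mem {M : Set ι} {x : Op ι} (hx : x ∈ modeAlgebra M) :
    xᴴ ∈ modeAlgebra M := by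
  induction hx using modeAlgebra_induction with
  | ann i hi => exact create_mem hi
  | cre i hi => rw [Matrix.conjTranspose_conjTranspose]; exact annihilate_mem hi
  | scalar c =>
    rw [Matrix.conjTranspose_smul, Matrix.conjTranspose_one]
    exact Subalgebra.smul_mem _ (one_mem _) _
  | add x y _ _ hx hy => rw [Matrix.conjTranspose_add]; exact add_mem hx hy
  | mul x y _ _ hx hy => rw [Matrix.conjTranspose_mul]; exact mul_mem hy hx

theorem parity_conj_mem {M : Set ι} {x : Op ι} (hx : x ∈ modeAlgebra M) :
    parity * x * parity ∈ modeAlgebra M := by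
  induction hx using modeAlgebra_induction with
  | ann i hi => rw [parity_conj_annihilate]; exact neg_mem (annihilate_mem hi)
  | cre i hi => rw [parity_conj_create]; exact neg_mem (create_mem hi)
  | scalar c =>
    rw [mul_smul_comm, smul_mul_assoc, mul_one, parity_sq]
    exact Subalgebra.smul_mem _ (one_mem _) _
  | add x y _ _ hx hy => rw [mul_add, add_mul]; exact add_mem hx hy
  | mul x y _ _ hx hy =>
    have : parity * (x * y) * parity = (parity * x * parity) * (parity * y * parity) := by
      calc parity * (x * y) * parity = parity * x * (1 * (y * parity)) := by
            simp only [one_mul, mul_assoc]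
        _ = _ := by rw [← parity_sq]; simp only [mul_assoc]
    rw [this]; exact mul_mem hx hy

/-- Conjugation with the parity flips the sign of every generator, just as moving `y` past it does,
and both operations are multiplicative. -/
theorem supercommute {M : Set ι} {x y : Op ι} (hx : x ∈ modeAlgebra M)
    (hy : ∀ i ∈ M, y * annihilate i = -(annihilate i * y) ∧
      y * (annihilate i)ᴴ = -((annihilate i)ᴴ * y)) :
    y * x = parity * x * parity * y := by
  induction hx using modeAlgebra_induction with
  | ann i hi => rw [parity_conj_annihilate, (hy i hi).1, neg_mul]
  | cre i hi => rw [parity_conj_create, (hy i hi).2, neg_mul]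
  | scalar c => simp [parity_sq]
  | add x z _ _ hx hz => rw [mul_add, hx, hz]; simp only [mul_add, add_mul]
  | mul x z _ _ hx hz =>
    calc y * (x * z) = parity * x * parity * (y * z) := by rw [← mul_assoc, hx, mul_assoc]
      _ = parity * x * (parity * parity) * z * parity * y := by
        rw [hz]; simp only [mul_assoc]
      _ = _ := by rw [parity_sq]; simp only [mul_assoc, mul_one]

theorem annihilate_supercommute {M : Set ι} {x : Op ι} (hx : x ∈ modeAlgebra M) {j : ι}
    (hj : j ∉ M) : annihilate j * x = parity * x * parity * annihilate j :=
  supercommute hx fun i hi =>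
    ⟨annihilate_anticomm _ _, annihilate_create_anticomm fun h => hj (h ▸ hi)⟩

theorem create_supercommute {M : Set ι} {x : Op ι} (hx : x ∈ modeAlgebra M) {j : ι}
    (hj : j ∉ M) : (annihilate j)ᴴ * x = parity * x * parity * (annihilate j)ᴴ :=
  supercommute hx fun i hi => ⟨by
    rw [annihilate_create_anticomm (i := i) (j := j) fun h => hj (h ▸ hi), neg_neg],
    create_anticomm _ _⟩

theorem parity_conj_of_commute {x : Op ι} (h : Commute x parity) : parity * x * parity = x := by
  rw [← h.eq, mul_assoc, parity_sq, mul_one]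

/-- An even operator commutes with the algebra of a disjoint set of modes. -/
theorem commute_of_disjoint {M M' : Set ι} (hd : Disjoint M M') {x y : Op ι}
    (hx : x ∈ modeAlgebra M) (he : Commute x parity) (hy : y ∈ modeAlgebra M') :
    Commute x y := by
  have hn : ∀ j ∈ M', j ∉ M := fun j hj hjM => Set.disjoint_left.mp hd hjM hj
  induction hy using modeAlgebra_induction with
  | ann j hj =>
    have := annihilate_supercommute hx (hn j hj)
    rw [parity_conj_of_commute he] at this
    exact this.symm
  | cre j hj =>
    have := create_supercommute hx (hn j hj)
    rw [parity_conj_of_commute he] at this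
    exact this.symm
  | scalar c => exact (Commute.one_right x).smul_right c
  | add y z _ _ hy hz => exact hy.add_right hz
  | mul y z _ _ hy hz => exact hy.mul_right hz

/-- The algebra of a union is spanned by products. -/
theorem modeAlgebra_union_induction {M M' : Set ι}
    {p : (x : Op ι) → x ∈ modeAlgebra (M ∪ M') → Prop} (zero : p 0 (zero_mem _))
    (add : ∀ x y hx hy, p x hx → p y hy → p (x + y) (add_mem hx hy))
    (mul : ∀ x (hx : x ∈ modeAlgebra M) y (hy : y ∈ modeAlgebra M'), p (x * y)
      (mul_mem (modeAlgebra_mono Set.subset_union_left hx)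
        (modeAlgebra_mono Set.subset_union_right hy))) {x : Op ι}
    (hx : x ∈ modeAlgebra (M ∪ M')) : p x hx := by
  -- The sums of such products are stable under left multiplication by every generator: it is
  -- absorbed by the left factor, or moved past it by supercommutation and absorbed by the right
  -- one.
  set V : AddSubmonoid (Op ι) :=
    AddSubmonoid.closure {z | ∃ x ∈ modeAlgebra M, ∃ y ∈ modeAlgebra M', z = x * y} with hV
  have key : ∀ z ∈ V, x * z ∈ V := by
    have gen : ∀ g : Op ι, (∀ x ∈ modeAlgebra M, ∀ y ∈ modeAlgebra M', g * (x * y) ∈ V) →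
        ∀ z ∈ V, g * z ∈ V := by
      intro g hg z hz
      induction hz using AddSubmonoid.closure_induction with
      | mem z hz => obtain ⟨x, hx, y, hy, rfl⟩ := hz; exact hg x hx y hy
      | zero => rw [mul_zero]; exact zero_mem _
      | add x y _ _ hx hy => rw [mul_add]; exact add_mem hx hy
    induction hx using modeAlgebra_induction with
    | ann i hi =>
      by_cases hM : i ∈ M
      · refine gen _ fun x hx y hy => AddSubmonoid.subset_closure ⟨annihilate i * x,
          mul_mem (annihilate_mem hM) hx, y, hy, by rw [mul_assoc]⟩
      · have hM' : i ∈ M' := hi.resolve_left hM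
        refine gen _ fun x hx y hy => AddSubmonoid.subset_closure ⟨parity * x * parity,
          parity_conj_mem hx, annihilate i * y, mul_mem (annihilate_mem hM') hy, ?_⟩
        rw [← mul_assoc, annihilate_supercommute hx hM]; simp only [mul_assoc]
    | cre i hi =>
      by_cases hM : i ∈ M
      · refine gen _ fun x hx y hy => AddSubmonoid.subset_closure ⟨(annihilate i)ᴴ * x,
          mul_mem (create_mem hM) hx, y, hy, by rw [mul_assoc]⟩
      · have hM' : i ∈ M' := hi.resolve_left hM
        refine gen _ fun x hx y hy => AddSubmonoid.subset_closure ⟨parity * x * parity,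
          parity_conj_mem hx, (annihilate i)ᴴ * y, mul_mem (create_mem hM') hy, ?_⟩
        rw [← mul_assoc, create_supercommute hx hM]; simp only [mul_assoc]
    | scalar c =>
      exact gen _ fun x hx y hy => AddSubmonoid.subset_closure ⟨c • x,
        Subalgebra.smul_mem _ hx c, y, hy, by simp only [smul_mul_assoc, one_mul]⟩
    | add x y _ _ hx hy => intro z hz; rw [add_mul]; exact add_mem (hx z hz) (hy z hz)
    | mul x y _ _ hx hy => intro z hz; rw [mul_assoc]; exact hx _ (hy _ hz)
  have h1 : x ∈ V := by
    have := key 1 (AddSubmonoid.subset_closure ⟨1, one_mem _, 1, one_mem _, by rw [mul_one]⟩)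
    rwa [mul_one] at this
  have h2 : ∃ h, p x h := by
    clear key hx
    induction h1 using AddSubmonoid.closure_induction with
    | mem z hz => obtain ⟨x, hx, y, hy, rfl⟩ := hz; exact ⟨_, mul x hx y hy⟩
    | zero => exact ⟨_, zero⟩
    | add x y _ _ hx hy =>
      obtain ⟨hx, hpx⟩ := hx; obtain ⟨hy, hpy⟩ := hy
      exact ⟨_, add x y hx hy hpx hpy⟩
  exact h2.2

end FockAlgebra

/-! ### States unentangled between a region and its complement. -/

section Pure

variable {ι : Type} [LinearOrder ι] [Fintype ι]

/-- Parity preserving unitaries in the algebra of a set of modes. -/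
structure IsLocalUnitary (M : Set ι) (u : Op ι) : Prop where
  mem : u ∈ modeAlgebra M
  left : uᴴ * u = 1
  right : u * uᴴ = 1
  even : Commute u parity

theorem commute_conjTranspose_parity {u : Op ι} (h : Commute u parity) : Commute uᴴ parity := by
  have := congrArg Matrix.conjTranspose h.eq
  rw [Matrix.conjTranspose_mul, Matrix.conjTranspose_mul, parity_conjTranspose] at this
  exact this.symm

namespace IsLocalUnitary

variable {M M' : Set ι} {u v : Op ι}

theorem one (M : Set ι) : IsLocalUnitary M (1 : Op ι) :=
  ⟨one_mem _, by simp, by simp, Commute.one_left _⟩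

theorem star (h : IsLocalUnitary M u) : IsLocalUnitary M uᴴ :=
  ⟨conjTranspose_mem h.mem, by rw [Matrix.conjTranspose_conjTranspose, h.right],
    by rw [Matrix.conjTranspose_conjTranspose, h.left], commute_conjTranspose_parity h.even⟩

theorem mul (h : IsLocalUnitary M u) (h' : IsLocalUnitary M v) : IsLocalUnitary M (u * v) where
  mem := mul_mem h.mem h'.mem
  left := by
    rw [Matrix.conjTranspose_mul, mul_assoc, ← mul_assoc uᴴ, h.left, one_mul, h'.left]
  right := by
    rw [Matrix.conjTranspose_mul, mul_assoc, ← mul_assoc v, h'.right, one_mul, h.right]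
  even := h.even.mul_left h'.even

theorem mono (h : IsLocalUnitary M u) (hM : M ⊆ M') : IsLocalUnitary M' u :=
  ⟨modeAlgebra_mono hM h.mem, h.left, h.right, h.even⟩

theorem commute (h : IsLocalUnitary M u) (hd : Disjoint M M') {x : Op ι}
    (hx : x ∈ modeAlgebra M') : Commute u x :=
  commute_of_disjoint hd h.mem h.even hx

theorem cancel_left (h : IsLocalUnitary M u) (x : Op ι) : uᴴ * (u * x) = x := by
  rw [← mul_assoc, h.left, one_mul]

theorem cancel_right (h : IsLocalUnitary M u) (x : Op ι) : u * (uᴴ * x) = x := by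
  rw [← mul_assoc, h.right, one_mul]

theorem mulVec_ne_zero (h : IsLocalUnitary M u) {ψ : State ι} (hψ : ψ ≠ 0) : u *ᵥ ψ ≠ 0 := by
  intro h0
  apply hψ
  rw [← Matrix.one_mulVec ψ, ← h.left, ← Matrix.mulVec_mulVec, h0, Matrix.mulVec_zero]

end IsLocalUnitary

/-- An even hermitian element `E` of the algebra of `R` with `E x E ∈ ℂ E` for all `x` in this
algebra. -/
structure IsMinimal (R : Set ι) (E : Op ι) : Prop where
  mem : E ∈ modeAlgebra R
  even : Commute E parity
  herm : Eᴴ = E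
  minimal : ∀ x ∈ modeAlgebra R, ∃ c : ℂ, E * x * E = c • E

/-- `ψ` is unentangled between the modes in `R` and the other ones. -/
def IsPureOn (R : Set ι) (ψ : State ι) : Prop := ∃ E : Op ι, IsMinimal R E ∧ E *ᵥ ψ = ψ

/-- Minimality with `x = 1` makes the square of `E` a multiple of `E`; the nonzero fixed vector
forces the factor 1. Idempotence thus need not be part of the definition. -/
theorem IsMinimal.idem {R : Set ι} {E : Op ι} (h : IsMinimal R E) {ψ : State ι} (hψ : ψ ≠ 0)
    (hE : E *ᵥ ψ = ψ) : E * E = E := by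
  obtain ⟨c, hc⟩ := h.minimal 1 (one_mem _)
  rw [mul_one] at hc
  have : c • ψ = ψ := by
    have := congrArg (· *ᵥ ψ) hc
    simp only [← Matrix.mulVec_mulVec, Matrix.smul_mulVec, hE] at this
    exact this.symm
  have hc1 : c = 1 := by
    have h' : (c - 1) • ψ = 0 := by rw [sub_smul, this, one_smul, sub_self]
    exact sub_eq_zero.mp ((smul_eq_zero.mp h').resolve_right hψ)
  rw [hc, hc1, one_smul]

theorem mem_modeAlgebra_empty {x : Op ι} (hx : x ∈ modeAlgebra (∅ : Set ι)) :
    ∃ c : ℂ, x = c • 1 := by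
  induction hx using modeAlgebra_induction with
  | ann i hi => exact hi.elim
  | cre i hi => exact hi.elim
  | scalar c => exact ⟨c, rfl⟩
  | add x y _ _ hx hy =>
    obtain ⟨c, rfl⟩ := hx; obtain ⟨d, rfl⟩ := hy
    exact ⟨c + d, by rw [add_smul]⟩
  | mul x y _ _ hx hy =>
    obtain ⟨c, rfl⟩ := hx; obtain ⟨d, rfl⟩ := hy
    exact ⟨c * d, by rw [smul_mul_smul_comm, mul_one]⟩

theorem isMinimal_empty : IsMinimal (∅ : Set ι) (1 : Op ι) :=
  ⟨one_mem _, Commute.one_left _, Matrix.conjTranspose_one, fun x hx => by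
    obtain ⟨c, rfl⟩ := mem_modeAlgebra_empty hx
    exact ⟨c, by simp⟩⟩

/-- The algebra of the union is spanned by products `x * y`, and even elements commute with the
algebra of a disjoint region, so the compression factors as `(E * x * E) * (E' * y * E')`. -/
theorem IsMinimal.mul {R R' : Set ι} (hd : Disjoint R R') {E E' : Op ι} (h : IsMinimal R E)
    (h' : IsMinimal R' E') : IsMinimal (R ∪ R') (E * E') where
  mem := mul_mem (modeAlgebra_mono Set.subset_union_left h.mem)
    (modeAlgebra_mono Set.subset_union_right h'.mem)
  even := h.even.mul_left h'.even
  herm := by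
    rw [Matrix.conjTranspose_mul, h.herm, h'.herm]
    exact (commute_of_disjoint hd h.mem h.even h'.mem).eq.symm
  minimal x hx := by
    have hc : Commute E E' := commute_of_disjoint hd h.mem h.even h'.mem
    induction hx using modeAlgebra_union_induction with
    | zero => exact ⟨0, by simp⟩
    | add x y _ _ hx hy =>
      obtain ⟨c, hc⟩ := hx; obtain ⟨d, hd⟩ := hy
      exact ⟨c + d, by rw [mul_add, add_mul, hc, hd, add_smul]⟩
    | mul x hx y hy =>
      obtain ⟨c, hc1⟩ := h.minimal x hx
      obtain ⟨d, hd1⟩ := h'.minimal y hy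
      have hx' : Commute E' x := commute_of_disjoint hd.symm h'.mem h'.even hx
      have hy' : Commute E y := commute_of_disjoint hd h.mem h.even hy
      refine ⟨c * d, ?_⟩
      calc E * E' * (x * y) * (E * E') = E * (E' * x) * (y * E) * E' := by simp only [mul_assoc]
        _ = E * x * (E' * E) * y * E' := by rw [hx'.eq, ← hy'.eq]; simp only [mul_assoc]
        _ = (E * x * E) * (E' * y * E') := by rw [← hc.eq]; simp only [mul_assoc]
        _ = _ := by rw [hc1, hd1, smul_mul_smul_comm]

theorem IsPureOn.union {R R' : Set ι} (hd : Disjoint R R') {ψ : State ι} (h : IsPureOn R ψ)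
    (h' : IsPureOn R' ψ) : IsPureOn (R ∪ R') ψ := by
  obtain ⟨E, hE, hEψ⟩ := h
  obtain ⟨E', hE', hEψ'⟩ := h'
  exact ⟨E * E', hE.mul hd hE', by rw [← Matrix.mulVec_mulVec, hEψ', hEψ]⟩

theorem isPureOn_empty (ψ : State ι) : IsPureOn ∅ ψ := ⟨1, isMinimal_empty, Matrix.one_mulVec ψ⟩

theorem IsPureOn.smul {R : Set ι} {ψ : State ι} (h : IsPureOn R ψ) (c : ℂ) :
    IsPureOn R (c • ψ) := by
  obtain ⟨E, hE, hEψ⟩ := h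
  exact ⟨E, hE, by rw [Matrix.mulVec_smul, hEψ]⟩

/-- Conjugation with an even unitary normalising the algebra of `R`. -/
theorem IsPureOn.normalizer {R : Set ι} {ψ : State ι} (h : IsPureOn R ψ) {u : Op ι}
    (hu : IsLocalUnitary Set.univ u) (h1 : ∀ x ∈ modeAlgebra R, u * x * uᴴ ∈ modeAlgebra R)
    (h2 : ∀ x ∈ modeAlgebra R, uᴴ * x * u ∈ modeAlgebra R) : IsPureOn R (u *ᵥ ψ) := by
  obtain ⟨E, hE, hEψ⟩ := h
  refine ⟨u * E * uᴴ, ⟨h1 E hE.mem, (hu.even.mul_left hE.even).mul_left hu.star.even, ?_, ?_⟩, ?_⟩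
  · simp only [Matrix.conjTranspose_mul, Matrix.conjTranspose_conjTranspose, hE.herm, mul_assoc]
  · intro x hx
    obtain ⟨c, hc⟩ := hE.minimal _ (h2 x hx)
    refine ⟨c, ?_⟩
    calc u * E * uᴴ * x * (u * E * uᴴ) = u * (E * (uᴴ * x * u) * E) * uᴴ := by
          simp only [mul_assoc]
      _ = _ := by rw [hc, mul_smul_comm, smul_mul_assoc]
  · rw [Matrix.mulVec_mulVec, mul_assoc, hu.left, mul_one, ← Matrix.mulVec_mulVec, hEψ]

theorem IsPureOn.inside {R M : Set ι} {ψ : State ι} (h : IsPureOn R ψ) {u : Op ι}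
    (hu : IsLocalUnitary M u) (hM : M ⊆ R) : IsPureOn R (u *ᵥ ψ) :=
  h.normalizer (hu.mono (Set.subset_univ M))
    (fun _ hx => mul_mem (mul_mem (hu.mono hM).mem hx) (hu.mono hM).star.mem)
    (fun _ hx => mul_mem (mul_mem (hu.mono hM).star.mem hx) (hu.mono hM).mem)

/-- The same projection serves, because an even unitary supported elsewhere commutes with it. -/
theorem IsPureOn.outside {R M : Set ι} {ψ : State ι} (h : IsPureOn R ψ) {u : Op ι}
    (hu : IsLocalUnitary M u) (hM : Disjoint M R) : IsPureOn R (u *ᵥ ψ) := by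
  obtain ⟨E, hE, hEψ⟩ := h
  refine ⟨E, hE, ?_⟩
  rw [Matrix.mulVec_mulVec, ← (hu.commute hM hE.mem).eq, ← Matrix.mulVec_mulVec, hEψ]

theorem IsPureOn.of_mulVec_inside {R M : Set ι} {ψ : State ι} {u : Op ι}
    (h : IsPureOn R (u *ᵥ ψ)) (hu : IsLocalUnitary M u) (hM : M ⊆ R) : IsPureOn R ψ := by
  have := h.inside hu.star hM
  rwa [Matrix.mulVec_mulVec, hu.left, Matrix.one_mulVec] at this

theorem IsPureOn.of_mulVec_outside {R M : Set ι} {ψ : State ι} {u : Op ι}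
    (h : IsPureOn R (u *ᵥ ψ)) (hu : IsLocalUnitary M u) (hM : Disjoint M R) : IsPureOn R ψ := by
  have := h.outside hu.star hM
  rwa [Matrix.mulVec_mulVec, hu.left, Matrix.one_mulVec] at this

open scoped ComplexOrder in
theorem star_dotProduct_self_ne_zero {ψ : State ι} (hψ : ψ ≠ 0) : star ψ ⬝ᵥ ψ ≠ 0 := by
  exact fun h => hψ (dotProduct_star_self_eq_zero.mp h)

/-- Hermiticity lets `E` be absorbed into the bra as well as the ket, which identifies the scalar of
minimality with an expectation value. -/
theorem IsMinimal.exists_expectation {R : Set ι} {E : Op ι} (h : IsMinimal R E) {ψ : State ι}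
    (hψ : ψ ≠ 0) (hE : E *ᵥ ψ = ψ) {x : Op ι} (hx : x ∈ modeAlgebra R) :
    E * x * E = ((star ψ ⬝ᵥ (x *ᵥ ψ)) / (star ψ ⬝ᵥ ψ)) • E := by
  obtain ⟨c, hc⟩ := h.minimal x hx
  rw [hc]
  congr 1
  have hne : star ψ ⬝ᵥ ψ ≠ 0 := star_dotProduct_self_ne_zero hψ
  rw [eq_div_iff hne]
  have h1 : E *ᵥ (x *ᵥ ψ) = c • ψ := by
    have := congrArg (· *ᵥ ψ) hc
    simpa only [← Matrix.mulVec_mulVec, Matrix.smul_mulVec, hE] using this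
  have h2 : star ψ ᵥ* E = star ψ := by
    have := congrArg Star.star hE
    rwa [Matrix.star_mulVec, h.herm] at this
  have h3 : star ψ ⬝ᵥ (E *ᵥ (x *ᵥ ψ)) = star ψ ⬝ᵥ (x *ᵥ ψ) := by
    rw [Matrix.dotProduct_mulVec, h2]
  rw [← h3, h1, dotProduct_smul, smul_eq_mul]

/-- If `ψ` is pure on two overlapping regions, it is pure on their union. -/
theorem IsPureOn.union_of_overlap {R₁ R₂ R₃ : Set ι} (h₁₂ : Disjoint R₁ R₂)
    (h₁₃ : Disjoint R₁ R₃) (h₂₃ : Disjoint R₂ R₃) {ψ : State ι} (hψ : ψ ≠ 0)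
    (hl : IsPureOn (R₁ ∪ R₂) ψ) (hr : IsPureOn (R₂ ∪ R₃) ψ) : IsPureOn (R₁ ∪ (R₂ ∪ R₃)) ψ := by
  obtain ⟨E, hE, hEψ⟩ := hl
  obtain ⟨F, hF, hFψ⟩ := hr
  have hEE := hE.idem hψ hEψ
  have hFF := hF.idem hψ hFψ
  set ω : Op ι → ℂ := fun x => (star ψ ⬝ᵥ (x *ᵥ ψ)) / (star ψ ⬝ᵥ ψ) with hω
  have hωE : ∀ x ∈ modeAlgebra (R₁ ∪ R₂), E * x * E = ω x • E := fun x hx =>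
    hE.exists_expectation hψ hEψ hx
  have hωF : ∀ x ∈ modeAlgebra (R₂ ∪ R₃), F * x * F = ω x • F := fun x hx =>
    hF.exists_expectation hψ hFψ hx
  have hd1 : Disjoint (R₂ ∪ R₃) R₁ := Set.disjoint_union_left.mpr ⟨h₁₂.symm, h₁₃.symm⟩
  have hd3 : Disjoint (R₁ ∪ R₂) R₃ := Set.disjoint_union_left.mpr ⟨h₁₃, h₂₃⟩
  have hF1 : ∀ x ∈ modeAlgebra R₁, Commute F x := fun x hx =>
    commute_of_disjoint hd1 hF.mem hF.even hx
  have hE3 : ∀ x ∈ modeAlgebra R₃, Commute E x := fun x hx =>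
    commute_of_disjoint hd3 hE.mem hE.even hx
  have hm1 : ∀ x ∈ modeAlgebra R₁, x ∈ modeAlgebra (R₁ ∪ R₂) := fun x hx =>
    modeAlgebra_mono Set.subset_union_left hx
  have hm2 : ∀ x ∈ modeAlgebra R₂, x ∈ modeAlgebra (R₁ ∪ R₂) := fun x hx =>
    modeAlgebra_mono Set.subset_union_right hx
  have hm2' : ∀ x ∈ modeAlgebra R₂, x ∈ modeAlgebra (R₂ ∪ R₃) := fun x hx =>
    modeAlgebra_mono Set.subset_union_left hx
  -- independence of `R₁` and `R₂`
  have hmul : ∀ x ∈ modeAlgebra R₁, ∀ y ∈ modeAlgebra R₂, ω (x * y) = ω x * ω y := by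
    intro x hx y hy
    have h1 : F *ᵥ (y *ᵥ ψ) = ω y • ψ := by
      have := congrArg (· *ᵥ ψ) (hωF y (hm2' y hy))
      simpa only [← Matrix.mulVec_mulVec, Matrix.smul_mulVec, hFψ] using this
    have h2 : star ψ ᵥ* F = star ψ := by
      have := congrArg Star.star hFψ
      rwa [Matrix.star_mulVec, hF.herm] at this
    have h3 : star ψ ⬝ᵥ ((x * y) *ᵥ ψ) = ω y * (star ψ ⬝ᵥ (x *ᵥ ψ)) := by
      calc star ψ ⬝ᵥ ((x * y) *ᵥ ψ) = star ψ ⬝ᵥ (F *ᵥ ((x * y) *ᵥ ψ)) := by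
            rw [Matrix.dotProduct_mulVec (star ψ) F, h2]
        _ = star ψ ⬝ᵥ (x *ᵥ (F *ᵥ (y *ᵥ ψ))) := by
            rw [Matrix.mulVec_mulVec, ← mul_assoc, (hF1 x hx).eq, mul_assoc,
              ← Matrix.mulVec_mulVec, ← Matrix.mulVec_mulVec]
        _ = _ := by rw [h1, Matrix.mulVec_smul, dotProduct_smul, smul_eq_mul]
    simp only [hω] at h3 ⊢
    rw [h3]; ring
  -- Independence extends from `R₂` to `R₂ ∪ R₃` under compression by `E`, since factors from `R₃`
  -- commute with `E` and can be pulled out.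
  have hkey : ∀ x ∈ modeAlgebra R₁, ∀ y ∈ modeAlgebra (R₂ ∪ R₃),
      E * x * y * E = ω x • (E * y * E) := by
    intro x hx y hy
    induction hy using modeAlgebra_union_induction with
    | zero => simp
    | add y z _ _ hy hz => simp only [mul_add, add_mul, smul_add, hy, hz]
    | mul y hy z hz =>
      have e : ∀ t, E * t * z * E = E * t * E * z := fun t => by
        rw [mul_assoc _ E z, (hE3 z hz).eq, mul_assoc _ z E]
      calc E * x * (y * z) * E = E * (x * y) * z * E := by simp only [mul_assoc]
        _ = ω (x * y) • (E * z) := by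
          rw [e, hωE _ (mul_mem (hm1 x hx) (hm2 y hy)), smul_mul_assoc]
        _ = ω x • (E * y * E * z) := by
          rw [hωE y (hm2 y hy), hmul x hx y hy, smul_mul_assoc, smul_smul]
        _ = _ := by rw [← e, mul_assoc E y z]
  -- `E` and `F` need not commute, so the symmetric product is used as the projection of the union.
  -- Its minimality follows by commuting `F` past `R₁`, compressing `R₂ ∪ R₃` by `F`, and then
  -- applying `hkey` with `y = F`.
  refine ⟨E * F * E, ⟨?_, (hE.even.mul_left hF.even).mul_left hE.even, ?_, ?_⟩, ?_⟩
  · have hE' : E ∈ modeAlgebra (R₁ ∪ (R₂ ∪ R₃)) :=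
      modeAlgebra_mono (by rw [← Set.union_assoc]; exact Set.subset_union_left) hE.mem
    exact mul_mem (mul_mem hE' (modeAlgebra_mono Set.subset_union_right hF.mem)) hE'
  · simp only [Matrix.conjTranspose_mul, hE.herm, hF.herm, mul_assoc]
  · intro x hx
    have hE' : E ∈ modeAlgebra (R₁ ∪ (R₂ ∪ R₃)) :=
      modeAlgebra_mono (by rw [← Set.union_assoc]; exact Set.subset_union_left) hE.mem
    have aux : ∀ x ∈ modeAlgebra (R₁ ∪ (R₂ ∪ R₃)), ∃ c : ℂ,
        E * F * x * (F * E) = c • (E * F * E) := by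
      intro x hx
      induction hx using modeAlgebra_union_induction with
      | zero => exact ⟨0, by simp⟩
      | add x y _ _ hx hy =>
        obtain ⟨c, hc⟩ := hx; obtain ⟨d, hd⟩ := hy
        exact ⟨c + d, by rw [mul_add, add_mul, hc, hd, add_smul]⟩
      | mul x hx y hy =>
        refine ⟨ω y * ω x, ?_⟩
        calc E * F * (x * y) * (F * E) = E * (F * x) * (y * (F * E)) := by simp only [mul_assoc]
          _ = E * x * (F * y * F) * E := by rw [(hF1 x hx).eq]; simp only [mul_assoc]
          _ = ω y • (E * x * F * E) := by rw [hωF y hy, mul_smul_comm, smul_mul_assoc]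
          _ = _ := by rw [hkey x hx F hF.mem, smul_smul]
    obtain ⟨c, hc⟩ := aux _ (mul_mem (mul_mem hE' hx) hE')
    exact ⟨c, by rw [← hc]; simp only [mul_assoc]⟩
  · rw [← Matrix.mulVec_mulVec, ← Matrix.mulVec_mulVec, hEψ, hFψ, hEψ]

/-- The end points of a region on which the state is pure can be cut in different ways,
provided that both ways have intermediate cuts. -/
theorem IsPureOn.mix {R₁ R₂ R₃ Me Mf Mh Ml : Set ι} {ψ : State ι} (hψ : ψ ≠ 0) {e f h l : Op ι}
    (h₁₂ : Disjoint R₁ R₂) (h₁₃ : Disjoint R₁ R₃) (h₂₃ : Disjoint R₂ R₃)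
    (he : IsLocalUnitary Me e) (hf : IsLocalUnitary Mf f) (hh : IsLocalUnitary Mh h)
    (hl : IsLocalUnitary Ml l) (hMe : Disjoint Me (R₂ ∪ R₃)) (hMl : Disjoint Ml (R₁ ∪ R₂))
    (hMf : Mf ⊆ R₁ ∪ R₂) (hMh : Mh ⊆ R₂ ∪ R₃) (hfh : Disjoint Mf Mh) (hel : Disjoint Me Ml)
    (hef : Disjoint Me Mf) (hlh : Disjoint Ml Mh)
    (H₁ : IsPureOn (R₁ ∪ R₂) ((e * h) *ᵥ ψ)) (H₂ : IsPureOn (R₂ ∪ R₃) ((f * l) *ᵥ ψ)) :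
    IsPureOn (R₁ ∪ (R₂ ∪ R₃)) ((e * l) *ᵥ ψ) := by
  have cfh : Commute f h := hf.commute hfh hh.mem
  have cel : Commute e l := he.commute hel hl.mem
  have clh : Commute l h := hl.commute hlh hh.mem
  have cef : Commute e f := he.commute hef hf.mem
  have ceh : Commute e h := he.commute (hMe.mono_right hMh) hh.mem
  have clf : Commute l f := hl.commute (hMl.mono_right hMf) hf.mem
  -- The missing unitaries are added to both states, each inside or outside the region concerned, so
  -- that both purity statements concern the vector `(f * h * (e * l)) *ᵥ ψ`. On the union, `f` and
  -- `h` are interior and can be removed again.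
  have P₁ := (H₁.outside hl hMl).inside hf hMf
  have P₂ := (H₂.inside hh hMh).outside he hMe
  rw [Matrix.mulVec_mulVec, Matrix.mulVec_mulVec] at P₁ P₂
  have e1 : f * (l * (e * h)) = f * h * (e * l) := by
    rw [← mul_assoc l, ← cel.eq, mul_assoc, clh.eq, ← mul_assoc e, ceh.eq]
    simp only [mul_assoc]
  have e2 : e * (h * (f * l)) = f * h * (e * l) := by
    rw [← mul_assoc h, ← cfh.eq, ← mul_assoc e, ← mul_assoc e, cef.eq, mul_assoc f, ceh.eq]
    simp only [mul_assoc]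
  rw [mul_assoc, e1] at P₁
  rw [mul_assoc, e2] at P₂
  have hne : (f * h * (e * l)) *ᵥ ψ ≠ 0 :=
    (((hf.mono (Set.subset_univ _)).mul (hh.mono (Set.subset_univ _))).mul
      ((he.mono (Set.subset_univ _)).mul (hl.mono (Set.subset_univ _)))).mulVec_ne_zero hψ
  have P := P₁.union_of_overlap h₁₂ h₁₃ h₂₃ hne P₂
  rw [← Matrix.mulVec_mulVec, ← Matrix.mulVec_mulVec] at P
  refine (P.of_mulVec_inside hf (hMf.trans ?_)).of_mulVec_inside hh
    (hMh.trans Set.subset_union_right)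
  rw [← Set.union_assoc]; exact Set.subset_union_left

end Pure

/-! ### Operators of mode permutations and conjugation with them. -/

section Permutations

variable {ι : Type} [LinearOrder ι] [Fintype ι]

/-- The sign of the number of inversions of `σ` on `s`. -/
def inversionSign (σ : Equiv.Perm ι) (s : Finset ι) : ℂ :=
  (-1) ^ ((s ×ˢ s).filter fun p => p.1 < p.2 ∧ σ p.2 < σ p.1).card

theorem inversionSign_mul_self (σ : Equiv.Perm ι) (s : Finset ι) :
    inversionSign σ s * inversionSign σ s = 1 := by
  rw [inversionSign, ← mul_pow]; simp

theorem map_symm_map (σ : Equiv.Perm ι) (s : Finset ι) :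
    (s.map σ.toEmbedding).map σ.symm.toEmbedding = s := by
  ext; simp

theorem map_map_symm (σ : Equiv.Perm ι) (s : Finset ι) :
    (s.map σ.symm.toEmbedding).map σ.toEmbedding = s := by
  ext; simp

theorem permOp_mulVec (σ : Equiv.Perm ι) (ψ : State ι) (t : Finset ι) :
    (permOp σ *ᵥ ψ) t = inversionSign σ (t.map σ.symm.toEmbedding) *
      ψ (t.map σ.symm.toEmbedding) := by
  simp only [Matrix.mulVec, dotProduct, permOp, Matrix.of_apply]
  rw [Finset.sum_eq_single (t.map σ.symm.toEmbedding)]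
  · rw [if_pos (map_map_symm σ t).symm]; rfl
  · intro s _ hs
    rw [if_neg, zero_mul]
    rintro rfl
    exact hs (map_symm_map σ s).symm
  · simp

theorem permOp_conjTranspose_mulVec (σ : Equiv.Perm ι) (ψ : State ι) (s : Finset ι) :
    ((permOp σ)ᴴ *ᵥ ψ) s = inversionSign σ s * ψ (s.map σ.toEmbedding) := by
  simp only [Matrix.mulVec, dotProduct, permOp, Matrix.of_apply, Matrix.conjTranspose_apply]
  rw [Finset.sum_eq_single (s.map σ.toEmbedding)]
  · simp [inversionSign]
  · intro t _ ht
    simp [ht]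
  · simp

theorem permOp_conjTranspose_mul (σ : Equiv.Perm ι) : (permOp σ)ᴴ * permOp σ = 1 := by
  apply op_ext; intro ψ; ext s
  rw [← Matrix.mulVec_mulVec, permOp_conjTranspose_mulVec, permOp_mulVec, map_symm_map,
    ← mul_assoc, inversionSign_mul_self, one_mul, Matrix.one_mulVec]

theorem permOp_mul_conjTranspose (σ : Equiv.Perm ι) : permOp σ * (permOp σ)ᴴ = 1 := by
  apply op_ext; intro ψ; ext s
  rw [← Matrix.mulVec_mulVec, permOp_mulVec, permOp_conjTranspose_mulVec, map_map_symm,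
    ← mul_assoc, inversionSign_mul_self, one_mul, Matrix.one_mulVec]

theorem permOp_mul_create (σ : Equiv.Perm ι) (i : ι) :
    permOp σ * (annihilate i)ᴴ = (annihilate (σ i))ᴴ * permOp σ := by
  have h := congrArg Matrix.conjTranspose (permOp_mul_annihilate σ i)
  rw [Matrix.conjTranspose_mul, Matrix.conjTranspose_mul] at h
  calc permOp σ * (annihilate i)ᴴ = permOp σ * ((annihilate i)ᴴ * (permOp σ)ᴴ) * permOp σ := by
        rw [mul_assoc, mul_assoc, permOp_conjTranspose_mul, mul_one]
    _ = _ := by rw [h, ← mul_assoc, permOp_mul_conjTranspose, one_mul]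

theorem commute_permOp_parity (σ : Equiv.Perm ι) : Commute (permOp σ) parity := by
  apply op_ext; intro ψ; ext s
  rw [← Matrix.mulVec_mulVec, ← Matrix.mulVec_mulVec, permOp_mulVec, parity_mulVec,
    parity_mulVec, permOp_mulVec, Finset.card_map]
  ring

/-- An operator is determined by its action on the vacuum and its commutation relations with the
creation operators. -/
theorem op_eq_of_create {X Y : Op ι} (σ : ι → ι) (hv : X *ᵥ vacuum = Y *ᵥ vacuum)
    (hX : ∀ i, X * (annihilate i)ᴴ = (annihilate (σ i))ᴴ * X)
    (hY : ∀ i, Y * (annihilate i)ᴴ = (annihilate (σ i))ᴴ * Y) : X = Y := by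
  have key : ∀ s : Finset ι, X *ᵥ Pi.single s 1 = Y *ᵥ Pi.single s 1 := by
    intro s
    induction s using Finset.induction_on with
    | empty => exact hv
    | insert i s hi ih =>
      have e : (Pi.single (insert i s) 1 : State ι) =
          jwSign i s • ((annihilate i)ᴴ *ᵥ Pi.single s 1) := by
        ext t
        rw [Pi.smul_apply, create_mulVec, smul_eq_mul]
        by_cases ht : t = insert i s
        · subst ht
          rw [if_pos (Finset.mem_insert_self i s), Finset.erase_insert hi, jwSign_insert hi,
            if_neg (lt_irrefl i)]
          simp [jwSign_mul_self]
        · rw [Pi.single_eq_of_ne ht]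
          split_ifs with hit
          · rw [Pi.single_eq_of_ne, mul_zero, mul_zero]
            rintro rfl
            exact ht (Finset.insert_erase hit).symm
          · rw [mul_zero]
      rw [e, Matrix.mulVec_smul, Matrix.mulVec_smul, Matrix.mulVec_mulVec, Matrix.mulVec_mulVec,
        hX, hY, ← Matrix.mulVec_mulVec, ← Matrix.mulVec_mulVec, ih]
  exact Matrix.ext_of_mulVec_single key

theorem permOp_mul (σ τ : Equiv.Perm ι) :
    (permOp (σ * τ) : Op ι) = permOp σ * permOp τ := by
  refine op_eq_of_create (σ * τ) ?_ (permOp_mul_create _) fun i => ?_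
  · rw [← Matrix.mulVec_mulVec, permOp_mulVec_vacuum, permOp_mulVec_vacuum, permOp_mulVec_vacuum]
  · rw [mul_assoc, permOp_mul_create, ← mul_assoc, permOp_mul_create, mul_assoc]; rfl

theorem permOp_one : (permOp 1 : Op ι) = 1 := by
  refine op_eq_of_create id ?_ (permOp_mul_create _) fun i => ?_
  · rw [permOp_mulVec_vacuum, Matrix.one_mulVec]
  · rw [one_mul, mul_one]; rfl

/-- A transposition is the parity of the normalised antisymmetric mode (c_i - c_j)/√2, that is, 1
minus twice its number operator. -/
theorem permOp_swap {i j : ι} (hij : i ≠ j) : (permOp (Equiv.swap i j) : Op ι) =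
    1 - (annihilate i - annihilate j)ᴴ * (annihilate i - annihilate j) := by
  have vac : ∀ i : ι, annihilate i *ᵥ vacuum = 0 := by
    intro i; ext t
    rw [annihilate_mulVec]
    split_ifs
    · rfl
    · rw [vacuum, Pi.single_eq_of_ne (Finset.insert_ne_empty i t), mul_zero]; rfl
  refine op_eq_of_create (Equiv.swap i j) ?_ (permOp_mul_create _) fun m => ?_
  · rw [permOp_mulVec_vacuum, Matrix.sub_mulVec, ← Matrix.mulVec_mulVec, Matrix.sub_mulVec, vac,
      vac, sub_zero, Matrix.mulVec_zero, sub_zero, Matrix.one_mulVec]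
  have e1 : ∀ m : ι, annihilate m * (annihilate m)ᴴ = 1 - (annihilate m)ᴴ * annihilate m :=
    fun m => eq_sub_of_add_eq (annihilate_create_self m)
  rw [Matrix.conjTranspose_sub]
  by_cases hmi : m = i
  · subst hmi
    rw [Equiv.swap_apply_left]
    simp only [sub_mul, mul_sub, one_mul, mul_one, mul_assoc, e1,
      annihilate_create_anticomm (Ne.symm hij)]
    simp only [← mul_assoc, create_sq, create_anticomm j m, mul_neg, neg_mul, zero_mul]
    abel
  by_cases hmj : m = j
  · subst hmj
    rw [Equiv.swap_apply_right]
    simp only [sub_mul, mul_sub, one_mul, mul_one, mul_assoc, e1, annihilate_create_anticomm hij]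
    simp only [← mul_assoc, create_sq, create_anticomm i m, mul_neg, neg_mul, zero_mul]
    abel
  · rw [Equiv.swap_apply_of_ne_of_ne hmi hmj]
    simp only [sub_mul, mul_sub, one_mul, mul_one, mul_assoc,
      annihilate_create_anticomm (Ne.symm hmi), annihilate_create_anticomm (Ne.symm hmj)]
    simp only [← mul_assoc, create_anticomm m i, create_anticomm m j, mul_neg, neg_mul]

/-- Such a permutation is a product of transpositions of modes in `M`, and each of these lies in the
algebra by `permOp_swap`. -/
theorem permOp_mem {M : Set ι} {σ : Equiv.Perm ι} (h : ∀ m ∉ M, σ m = m) :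
    permOp σ ∈ modeAlgebra M := by
  classical
  have key : ∀ τ : Equiv.Perm M, permOp (Equiv.Perm.ofSubtype τ : Equiv.Perm ι) ∈ modeAlgebra M := by
    intro τ
    induction τ using Equiv.Perm.swap_induction_on with
    | one => rw [map_one, permOp_one]; exact one_mem _
    | swap_mul τ x y hxy ih =>
      rw [map_mul, permOp_mul, Equiv.Perm.ofSubtype_swap_eq,
        permOp_swap (fun e => hxy (Subtype.ext e))]
      refine mul_mem (sub_mem (one_mem _) (mul_mem (conjTranspose_mem ?_) ?_)) ih <;>
        exact sub_mem (annihilate_mem x.2) (annihilate_mem y.2)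
  have hM : ∀ m, m ∈ M ↔ σ m ∈ M := by
    intro m
    by_cases hm : m ∈ M
    · refine ⟨fun _ => ?_, fun _ => hm⟩
      by_contra hσ
      have := σ.injective (h _ hσ)
      rw [this] at hσ
      exact hσ hm
    · rw [h m hm]
  have e := Equiv.Perm.ofSubtype_subtypePerm (p := (· ∈ M)) (f := σ) (fun m => (hM m).symm)
    (fun m hm => by by_contra hmM; exact hm (h m hmM))
  rw [← e]
  exact key _

/-- Conjugation with the operator of a permutation. -/
def conjPerm (σ : Equiv.Perm ι) (x : Op ι) : Op ι := permOp σ * x * (permOp σ)ᴴ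

theorem permOp_mul_eq (σ : Equiv.Perm ι) (x : Op ι) :
    permOp σ * x = conjPerm σ x * permOp σ := by
  rw [conjPerm, mul_assoc, permOp_conjTranspose_mul, mul_one]

theorem conjPerm_mul (σ : Equiv.Perm ι) (x y : Op ι) :
    conjPerm σ (x * y) = conjPerm σ x * conjPerm σ y := by
  simp only [conjPerm, mul_assoc]
  rw [← mul_assoc (permOp σ)ᴴ, permOp_conjTranspose_mul, one_mul]

theorem conjPerm_add (σ : Equiv.Perm ι) (x y : Op ι) :
    conjPerm σ (x + y) = conjPerm σ x + conjPerm σ y := by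
  simp only [conjPerm, mul_add, add_mul]

theorem conjPerm_smul (σ : Equiv.Perm ι) (c : ℂ) (x : Op ι) :
    conjPerm σ (c • x) = c • conjPerm σ x := by
  simp only [conjPerm, mul_smul_comm, smul_mul_assoc]

theorem conjPerm_one (σ : Equiv.Perm ι) : conjPerm σ (1 : Op ι) = 1 := by
  rw [conjPerm, mul_one, permOp_mul_conjTranspose]

theorem conjPerm_conjTranspose (σ : Equiv.Perm ι) (x : Op ι) :
    conjPerm σ xᴴ = (conjPerm σ x)ᴴ := by
  simp only [conjPerm, Matrix.conjTranspose_mul, Matrix.conjTranspose_conjTranspose, mul_assoc]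

theorem conjPerm_annihilate (σ : Equiv.Perm ι) (i : ι) :
    conjPerm σ (annihilate i) = annihilate (σ i) := by
  rw [conjPerm, permOp_mul_annihilate, mul_assoc, permOp_mul_conjTranspose, mul_one]

theorem conjPerm_comp (σ τ : Equiv.Perm ι) (x : Op ι) :
    conjPerm (σ * τ) x = conjPerm σ (conjPerm τ x) := by
  simp only [conjPerm, permOp_mul, Matrix.conjTranspose_mul, mul_assoc]

theorem conjPerm_mem {M M' : Set ι} {σ : Equiv.Perm ι} (h : ∀ m ∈ M, σ m ∈ M') {x : Op ι}
    (hx : x ∈ modeAlgebra M) : conjPerm σ x ∈ modeAlgebra M' := by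
  induction hx using modeAlgebra_induction with
  | ann i hi => rw [conjPerm_annihilate]; exact annihilate_mem (h i hi)
  | cre i hi =>
    rw [conjPerm_conjTranspose, conjPerm_annihilate]; exact create_mem (h i hi)
  | scalar c => rw [conjPerm_smul, conjPerm_one]; exact Subalgebra.smul_mem _ (one_mem _) c
  | add x y _ _ hx hy => rw [conjPerm_add]; exact add_mem hx hy
  | mul x y _ _ hx hy => rw [conjPerm_mul]; exact mul_mem hx hy

/-- Conjugation is determined by its effect on the generators. This is what allows a global rotation
to be replaced by a local exchange of blocks on operators supported in a block. -/
theorem conjPerm_congr {M : Set ι} {σ τ : Equiv.Perm ι} (h : ∀ m ∈ M, σ m = τ m) {x : Op ι}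
    (hx : x ∈ modeAlgebra M) : conjPerm σ x = conjPerm τ x := by
  induction hx using modeAlgebra_induction with
  | ann i hi => rw [conjPerm_annihilate, conjPerm_annihilate, h i hi]
  | cre i hi =>
    simp only [conjPerm_conjTranspose, conjPerm_annihilate, h i hi]
  | scalar c => rw [conjPerm_smul, conjPerm_one, conjPerm_smul, conjPerm_one]
  | add x y _ _ hx hy => rw [conjPerm_add, hx, hy, conjPerm_add]
  | mul x y _ _ hx hy => rw [conjPerm_mul, hx, hy, conjPerm_mul]

theorem conjPerm_refl (x : Op ι) : conjPerm 1 x = x := by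
  rw [conjPerm, permOp_one, one_mul, Matrix.conjTranspose_one, mul_one]

theorem conjPerm_eq_self {M : Set ι} {σ : Equiv.Perm ι} (h : ∀ m ∈ M, σ m = m) {x : Op ι}
    (hx : x ∈ modeAlgebra M) : conjPerm σ x = x := by
  rw [conjPerm_congr (τ := 1) h hx, conjPerm_refl]

theorem conjPerm_even {σ : Equiv.Perm ι} {x : Op ι} (h : Commute x parity) :
    Commute (conjPerm σ x) parity :=
  ((commute_permOp_parity σ).mul_left h).mul_left
    (commute_conjTranspose_parity (commute_permOp_parity σ))

theorem IsLocalUnitary.conjPerm {M M' : Set ι} {u : Op ι} (hu : IsLocalUnitary M u)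
    {σ : Equiv.Perm ι} (h : ∀ m ∈ M, σ m ∈ M') : IsLocalUnitary M' (conjPerm σ u) where
  mem := conjPerm_mem h hu.mem
  left := by rw [← conjPerm_conjTranspose, ← conjPerm_mul, hu.left, conjPerm_one]
  right := by rw [← conjPerm_conjTranspose, ← conjPerm_mul, hu.right, conjPerm_one]
  even := conjPerm_even hu.even

theorem IsMinimal.conjPerm {R R' : Set ι} {E : Op ι} (hE : IsMinimal R E) {σ : Equiv.Perm ι}
    (h : ∀ m, m ∈ R ↔ σ m ∈ R') : IsMinimal R' (conjPerm σ E) where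
  mem := conjPerm_mem (fun m => (h m).mp) hE.mem
  even := conjPerm_even hE.even
  herm := by rw [← conjPerm_conjTranspose, hE.herm]
  minimal x hx := by
    have hx' : LatticeFermion.conjPerm σ⁻¹ x ∈ modeAlgebra R :=
      conjPerm_mem (fun m hm => (h _).mpr (by simpa using hm)) hx
    obtain ⟨c, hc⟩ := hE.minimal _ hx'
    refine ⟨c, ?_⟩
    rw [← conjPerm_smul, ← hc, conjPerm_mul, conjPerm_mul, ← conjPerm_comp, mul_inv_cancel,
      conjPerm_refl]

theorem permOp_mulVec_mulVec (σ : Equiv.Perm ι) (x : Op ι) (ψ : State ι) :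
    permOp σ *ᵥ (x *ᵥ ψ) = conjPerm σ x *ᵥ (permOp σ *ᵥ ψ) := by
  rw [Matrix.mulVec_mulVec, permOp_mul_eq, Matrix.mulVec_mulVec]

theorem IsPureOn.permOp_mulVec {R R' : Set ι} {ψ : State ι} (h : IsPureOn R ψ)
    {σ : Equiv.Perm ι} (hR : ∀ m, m ∈ R ↔ σ m ∈ R') : IsPureOn R' (permOp σ *ᵥ ψ) := by
  obtain ⟨E, hE, hEψ⟩ := h
  exact ⟨LatticeFermion.conjPerm σ E, hE.conjPerm hR, by rw [← permOp_mulVec_mulVec, hEψ]⟩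

theorem permOp_mulVec_ne_zero {σ : Equiv.Perm ι} {ψ : State ι} (hψ : ψ ≠ 0) :
    permOp σ *ᵥ ψ ≠ 0 := by
  intro h0
  apply hψ
  rw [← Matrix.one_mulVec ψ, ← permOp_conjTranspose_mul σ, ← Matrix.mulVec_mulVec, h0,
    Matrix.mulVec_zero]

end Permutations

/-! ### Purity of product states on groups of consecutive modes. -/

section Product

variable {ι : Type} [LinearOrder ι] [Fintype ι]

theorem isMinimal_singleton (i : ι) :
    IsMinimal ({i} : Set ι) (annihilate i * (annihilate i)ᴴ) := by
  set c := annihilate i with hc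
  have hcc : c * c = 0 := annihilate_sq i
  have hdd : cᴴ * cᴴ = 0 := create_sq i
  have hcd : c * cᴴ = 1 - cᴴ * c := eq_sub_of_add_eq (annihilate_create_self i)
  have hdE : cᴴ * (c * cᴴ) = cᴴ := by rw [hcd, mul_sub, mul_one, ← mul_assoc, hdd, zero_mul, sub_zero]
  refine ⟨mul_mem (annihilate_mem rfl) (create_mem rfl), ?_, ?_, fun x hx => ?_⟩
  · change c * cᴴ * parity = parity * (c * cᴴ)
    rw [← mul_assoc, hc, parity_mul_annihilate, neg_mul, mul_assoc (annihilate i) parity,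
      parity_mul_create, mul_neg, neg_neg, mul_assoc]
  · rw [Matrix.conjTranspose_mul, Matrix.conjTranspose_conjTranspose]
  -- The left ideal generated by the projection on the empty mode is spanned by `c * cᴴ` and `cᴴ`;
  -- multiplication by `c * cᴴ` from the left kills the second.
  · have key : (∃ a b : ℂ, x * (c * cᴴ) = a • (c * cᴴ) + b • cᴴ) ∧
        ∃ a b : ℂ, x * cᴴ = a • (c * cᴴ) + b • cᴴ := by
      induction hx using modeAlgebra_induction with
      | ann j hj =>
        obtain rfl : j = i := hj
        refine ⟨⟨0, 0, ?_⟩, 1, 0, ?_⟩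
        · rw [← hc, ← mul_assoc, hcc]; simp
        · rw [← hc]; simp
      | cre j hj =>
        obtain rfl : j = i := hj
        refine ⟨⟨0, 1, ?_⟩, 0, 0, ?_⟩
        · rw [← hc, hdE]; simp
        · rw [← hc, hdd]; simp
      | scalar z => exact ⟨⟨z, 0, by simp⟩, 0, z, by simp⟩
      | add x y _ _ hx hy =>
        obtain ⟨⟨a, b, h1⟩, a', b', h2⟩ := hx
        obtain ⟨⟨p, q, h3⟩, p', q', h4⟩ := hy
        refine ⟨⟨a + p, b + q, ?_⟩, a' + p', b' + q', ?_⟩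
        · rw [add_mul, h1, h3]; module
        · rw [add_mul, h2, h4]; module
      | mul x y _ _ hx hy =>
        obtain ⟨⟨a, b, h1⟩, a', b', h2⟩ := hx
        obtain ⟨⟨p, q, h3⟩, p', q', h4⟩ := hy
        refine ⟨⟨p * a + q * a', p * b + q * b', ?_⟩, p' * a + q' * a', p' * b + q' * b', ?_⟩
        · rw [mul_assoc, h3, mul_add, mul_smul_comm, mul_smul_comm, h1, h2]; module
        · rw [mul_assoc, h4, mul_add, mul_smul_comm, mul_smul_comm, h1, h2]; module
    obtain ⟨⟨a, b, h⟩, -⟩ := key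
    refine ⟨a, ?_⟩
    rw [mul_assoc, h, mul_add, mul_smul_comm, mul_smul_comm, mul_assoc c cᴴ cᴴ, hdd, mul_zero,
      smul_zero, add_zero, mul_assoc c cᴴ, hdE]

/-- A minimal projection fixing the states in which the modes in `M` are empty. -/
theorem exists_isMinimal_empty (M : Finset ι) : ∃ E : Op ι, IsMinimal (M : Set ι) E ∧
    ∀ ψ : State ι, (∀ s, ψ s ≠ 0 → Disjoint s M) → E *ᵥ ψ = ψ := by
  induction M using Finset.induction_on with
  | empty =>
    refine ⟨1, ?_, fun ψ _ => Matrix.one_mulVec ψ⟩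
    rw [Finset.coe_empty]; exact isMinimal_empty
  | insert i M hi ih =>
    obtain ⟨E, hE, hEψ⟩ := ih
    refine ⟨annihilate i * (annihilate i)ᴴ * E, ?_, fun ψ hψ => ?_⟩
    · rw [Finset.coe_insert, Set.insert_eq]
      exact (isMinimal_singleton i).mul (by simpa using hi) hE
    · rw [← Matrix.mulVec_mulVec, hEψ ψ fun s hs =>
        (hψ s hs).mono_right (Finset.subset_insert i M)]
      have h0 : annihilate i *ᵥ ψ = 0 := by
        ext t
        rw [annihilate_mulVec]
        split_ifs with h
        · rfl
        · have : ψ (insert i t) = 0 := by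
            by_contra hne
            exact Finset.disjoint_left.mp (hψ _ hne) (Finset.mem_insert_self i t)
              (Finset.mem_insert_self i M)
          rw [this, mul_zero]; rfl
      have := congrArg (· *ᵥ ψ) (annihilate_create_self i)
      simpa only [Matrix.add_mulVec, ← Matrix.mulVec_mulVec ψ (annihilate i)ᴴ, h0,
        Matrix.mulVec_zero, add_zero, Matrix.one_mulVec] using this

/-- The number of occupied modes below `M`. -/
def numBelow (M s : Finset ι) : ℕ := (s.filter fun j => j ∉ M ∧ ∃ a ∈ M, j < a).card

/-- The operator is the product of the creation operators of `A` in increasing order. Since no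
outside mode separates modes of `M`, each factor passes the same occupied modes below `M`. New
factors are added on the left with the smallest index, so no sign arises within `A`. -/
theorem exists_creator {M : Finset ι} (hM : ∀ j ∉ M, ∀ a ∈ M, ∀ b ∈ M, j < a → j < b)
    (A : Finset ι) (hA : A ⊆ M) : ∃ C ∈ modeAlgebra (M : Set ι),
      parity * C * parity = (-1 : ℂ) ^ A.card • C ∧
      ∀ ψ : State ι, (∀ s, ψ s ≠ 0 → Disjoint s M) → ∀ s, (C *ᵥ ψ) s =
        if s ∩ M = A then (-1) ^ (A.card * numBelow M s) * ψ (s \ M) else 0 := by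
  induction A using Finset.induction_on_min with
  | empty =>
    refine ⟨1, one_mem _, by simp [parity_sq], fun ψ hψ s => ?_⟩
    rw [Matrix.one_mulVec]
    split_ifs with h
    · rw [Finset.sdiff_eq_self_of_disjoint (Finset.disjoint_iff_inter_eq_empty.mpr h)]; simp
    · by_contra hne
      exact h (Finset.disjoint_iff_inter_eq_empty.mp (hψ s hne))
  | insert i A hmin ih =>
    have hiA : i ∉ A := fun h => lt_irrefl i (hmin i h)
    have hiM : i ∈ M := hA (Finset.mem_insert_self i A)
    obtain ⟨C, hC, hpar, hCψ⟩ := ih ((Finset.subset_insert i A).trans hA)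
    refine ⟨(annihilate i)ᴴ * C, mul_mem (create_mem hiM) hC, ?_, fun ψ hψ s => ?_⟩
    · rw [Finset.card_insert_of_notMem hiA, pow_succ, ← mul_assoc, parity_mul_create, neg_mul,
        neg_mul, mul_assoc, mul_assoc, ← mul_assoc parity, hpar]
      simp
    · rw [← Matrix.mulVec_mulVec, create_mulVec, hCψ ψ hψ]
      by_cases hs : s ∩ M = insert i A
      · have his : i ∈ s := by
          have : i ∈ s ∩ M := by rw [hs]; exact Finset.mem_insert_self i A
          exact (Finset.mem_inter.mp this).1
        have h1 : s.erase i ∩ M = A := by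
          rw [Finset.erase_inter, hs, Finset.erase_insert hiA]
        have h2 : s.erase i \ M = s \ M := by
          ext j; simp only [Finset.mem_sdiff, Finset.mem_erase]
          constructor
          · rintro ⟨⟨_, h⟩, h'⟩; exact ⟨h, h'⟩
          · rintro ⟨h, h'⟩; exact ⟨⟨fun e => h' (e ▸ hiM), h⟩, h'⟩
        have h3 : numBelow M (s.erase i) = numBelow M s := by
          unfold numBelow; congr 1; ext j
          simp only [Finset.mem_filter, Finset.mem_erase]
          constructor
          · rintro ⟨⟨_, h⟩, h'⟩; exact ⟨h, h'⟩
          · rintro ⟨h, h'⟩; exact ⟨⟨fun e => h'.1 (e ▸ hiM), h⟩, h'⟩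
        have h4 : jwSign i s = (-1) ^ numBelow M s := by
          unfold jwSign numBelow; congr 2; ext j
          simp only [Finset.mem_filter]
          refine and_congr_right fun hj => ⟨fun hlt => ⟨fun hjM => ?_, i, hiM, hlt⟩, ?_⟩
          · have : j ∈ insert i A := by rw [← hs]; exact Finset.mem_inter.mpr ⟨hj, hjM⟩
            rcases Finset.mem_insert.mp this with rfl | h
            · exact lt_irrefl _ hlt
            · exact lt_asymm hlt (hmin j h)
          · rintro ⟨hjM, a, ha, hlt⟩
            exact hM j hjM a ha i hiM hlt
        rw [if_pos his, if_pos h1, if_pos hs, h2, h3, h4, Finset.card_insert_of_notMem hiA,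
          add_mul, one_mul, pow_add]
        ring
      · rw [if_neg hs]
        split_ifs with his h1
        · exfalso; apply hs
          rw [← h1, Finset.erase_inter, Finset.insert_erase]
          exact Finset.mem_inter.mpr ⟨his, hiM⟩
        · rw [mul_zero]
        · rfl

/-- A state which is a product of a state of definite parity of the consecutive modes `M` and a
state of the other modes is pure on `M`. -/
theorem isPureOn_of_factor {M : Finset ι} (hM : ∀ j ∉ M, ∀ a ∈ M, ∀ b ∈ M, j < a → j < b)
    {φ : State ι} (hφ0 : φ ≠ 0) (g h : Finset ι → ℂ) (p : ℕ)
    (hg : ∀ A ⊆ M, g A ≠ 0 → (-1 : ℂ) ^ A.card = (-1) ^ p)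
    (hφ : ∀ s, φ s = g (s ∩ M) * h (s \ M)) : IsPureOn (M : Set ι) φ := by
  obtain ⟨P, hP, hPψ⟩ := exists_isMinimal_empty M
  choose! C hC hCpar hCψ using fun A (hA : A ⊆ M) => exists_creator hM A hA
  set f : Op ι := ∑ A ∈ M.powerset, g A • C A with hf
  have hfM : f ∈ modeAlgebra (M : Set ι) := sum_mem fun A hA =>
    Subalgebra.smul_mem _ (hC A (Finset.mem_powerset.mp hA)) _
  have hfpar : parity * f * parity = (-1 : ℂ) ^ p • f := by
    rw [hf, Finset.mul_sum, Finset.sum_mul, Finset.smul_sum]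
    refine Finset.sum_congr rfl fun A hA => ?_
    have hA := Finset.mem_powerset.mp hA
    rw [mul_smul_comm, smul_mul_assoc, hCpar A hA]
    by_cases h0 : g A = 0
    · simp [h0]
    · rw [hg A hA h0, smul_comm]
  -- The state with `M` emptied. The sign compensates the one from `exists_creator`, which is
  -- independent of `A` because all contributing `A` have the parity of `p`.
  set φ₀ : State ι := fun s => if Disjoint s M then (-1) ^ (p * numBelow M s) * h s else 0 with hφ₀
  have hφ₀s : ∀ s, φ₀ s ≠ 0 → Disjoint s M := by
    intro s hs
    by_contra hd
    exact hs (by simp [hφ₀, hd])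
  have hnb : ∀ s, numBelow M (s \ M) = numBelow M s := by
    intro s
    unfold numBelow; congr 1; ext j
    simp only [Finset.mem_filter, Finset.mem_sdiff]; tauto
  have hfφ : f *ᵥ φ₀ = φ := by
    ext s
    rw [hf, Matrix.sum_mulVec, Finset.sum_apply, Finset.sum_eq_single (s ∩ M)]
    · rw [Matrix.smul_mulVec, Pi.smul_apply, hCψ _ Finset.inter_subset_right _ hφ₀s, if_pos rfl,
        hφ, hφ₀]
      simp only [Finset.sdiff_disjoint, if_true, hnb, smul_eq_mul]
      by_cases h0 : g (s ∩ M) = 0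
      · simp [h0]
      · rw [pow_mul, hg _ Finset.inter_subset_right h0, ← pow_mul, ← mul_assoc ((-1) ^ _),
          ← pow_add, ← two_mul, pow_mul]
        simp
    · intro A hA hne
      rw [Matrix.smul_mulVec, Pi.smul_apply, hCψ A (Finset.mem_powerset.mp hA) _ hφ₀s,
        if_neg (Ne.symm hne), smul_zero]
    · intro hn
      exact absurd (Finset.mem_powerset.mpr Finset.inter_subset_right) hn
  have hφ₀0 : φ₀ ≠ 0 := by
    intro h0
    rw [h0, Matrix.mulVec_zero] at hfφ
    exact hφ0 hfφ.symm
  have hPφ₀ := hPψ φ₀ hφ₀s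
  have hPP := hP.idem hφ₀0 hPφ₀
  have hexp := hP.exists_expectation hφ₀0 hPφ₀ (mul_mem (conjTranspose_mem hfM) hfM)
  have hn : star φ₀ ⬝ᵥ ((fᴴ * f) *ᵥ φ₀) = star φ ⬝ᵥ φ := by
    rw [← Matrix.mulVec_mulVec, Matrix.dotProduct_mulVec, ← Matrix.star_mulVec, hfφ]
  rw [hn] at hexp
  set ν : ℂ := (star φ ⬝ᵥ φ) / (star φ₀ ⬝ᵥ φ₀) with hν
  have hν0 : ν ≠ 0 :=
    div_ne_zero (star_dotProduct_self_ne_zero hφ0) (star_dotProduct_self_ne_zero hφ₀0)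
  have hreal : ∀ ψ : State ι, star (star ψ ⬝ᵥ ψ) = star ψ ⬝ᵥ ψ := fun ψ => by
    rw [← Matrix.star_dotProduct_star, star_star, dotProduct_comm]
  have hνs : star ν = ν := by rw [hν, star_div₀, hreal, hreal]
  have hfl : parity * f = (-1 : ℂ) ^ p • (f * parity) := by
    rw [← smul_mul_assoc, ← hfpar, mul_assoc _ parity, parity_sq, mul_one]
  have hfr : fᴴ * parity = (-1 : ℂ) ^ p • (parity * fᴴ) := by
    have := congrArg Matrix.conjTranspose hfl
    simpa [Matrix.conjTranspose_mul, Matrix.conjTranspose_smul, parity_conjTranspose] using this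
  -- The projection on the state created by `f`; it is even because `f` has definite parity, and ν
  -- is the squared norm ratio of φ and φ₀.
  refine ⟨ν⁻¹ • (f * P * fᴴ), ⟨?_, ?_, ?_, ?_⟩, ?_⟩
  · exact Subalgebra.smul_mem _ (mul_mem (mul_mem hfM hP.mem) (conjTranspose_mem hfM)) _
  · apply Commute.smul_left
    change f * P * fᴴ * parity = parity * (f * P * fᴴ)
    rw [mul_assoc, hfr, ← mul_assoc parity, ← mul_assoc parity, hfl, mul_smul_comm,
      smul_mul_assoc, smul_mul_assoc, ← mul_assoc, mul_assoc f P, hP.even.eq, ← mul_assoc f]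
  · rw [Matrix.conjTranspose_smul, star_inv₀, hνs]
    simp only [Matrix.conjTranspose_mul, Matrix.conjTranspose_conjTranspose, hP.herm, mul_assoc]
  · intro x hx
    obtain ⟨c, hc⟩ := hP.minimal _ (mul_mem (mul_mem (conjTranspose_mem hfM) hx) hfM)
    refine ⟨ν⁻¹ * c, ?_⟩
    calc ν⁻¹ • (f * P * fᴴ) * x * ν⁻¹ • (f * P * fᴴ)
        = (ν⁻¹ * ν⁻¹) • (f * (P * (fᴴ * x * f) * P) * fᴴ) := by
          simp only [smul_mul_assoc, mul_smul_comm, smul_smul, mul_assoc]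
      _ = _ := by
          rw [hc]; simp only [smul_mul_assoc, mul_smul_comm, smul_smul]; congr 1; ring
  · have h1 : (P * (fᴴ * f) * P) *ᵥ φ₀ = ν • φ₀ := by
      rw [hexp, Matrix.smul_mulVec, hPφ₀]
    rw [Matrix.smul_mulVec]
    conv_lhs => rw [← hfφ, Matrix.mulVec_mulVec]
    have h2 : (f * P * fᴴ * f) *ᵥ φ₀ = f *ᵥ ((P * (fᴴ * f) * P) *ᵥ φ₀) := by
      rw [← Matrix.mulVec_mulVec φ₀ _ P, hPφ₀, Matrix.mulVec_mulVec]; simp only [mul_assoc]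
    rw [h2, h1, Matrix.mulVec_smul, hfφ, smul_smul, inv_mul_cancel₀ hν0, one_smul]

end Product

/-! ### Circuits, their light cones and the removal of gates. -/

section Circuits

variable {ι : Type} [LinearOrder ι] [Fintype ι]

/-- A product of gates with pairwise disjoint supports satisfying `𝒢`. -/
def IsLayerOn (𝒢 : Set ι → Prop) (A : Op ι) : Prop :=
  ∃ l : List (Set ι × Op ι), (∀ g ∈ l, 𝒢 g.1 ∧ IsLocalUnitary g.1 g.2) ∧
    l.Pairwise (fun g h => Disjoint g.1 h.1) ∧ A = (l.map Prod.snd).prod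

/-- A circuit of given depth, with all supports of gates satisfying `𝒢`. -/
def IsCircuitOn (𝒢 : Set ι → Prop) : ℕ → Op ι → Prop
  | 0, U => U = 1
  | D + 1, U => ∃ V A, IsCircuitOn 𝒢 D V ∧ IsLayerOn 𝒢 A ∧ U = V * A

theorem IsLayerOn.isLocalUnitary {𝒢 : Set ι → Prop} {A : Op ι} (h : IsLayerOn 𝒢 A) {R : Set ι}
    (hR : ∀ M, 𝒢 M → M ⊆ R) : IsLocalUnitary R A := by
  obtain ⟨l, hl, -, rfl⟩ := h
  induction l with
  | nil => exact IsLocalUnitary.one R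
  | cons g l ih =>
    rw [List.map_cons, List.prod_cons]
    have hg := hl g List.mem_cons_self
    exact (hg.2.mono (hR _ hg.1)).mul (ih fun g' hg' => hl g' (List.mem_cons_of_mem _ hg'))

theorem IsLayerOn.commute {𝒢 : Set ι → Prop} {A : Op ι} (h : IsLayerOn 𝒢 A) {R : Set ι}
    (hR : ∀ M, 𝒢 M → Disjoint M R) {x : Op ι} (hx : x ∈ modeAlgebra R) : Commute A x := by
  obtain ⟨l, hl, -, rfl⟩ := h
  induction l with
  | nil => exact Commute.one_left x
  | cons g l ih =>
    rw [List.map_cons, List.prod_cons]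
    have hg := hl g List.mem_cons_self
    exact (hg.2.commute (hR _ hg.1) hx).mul_left
      (ih fun g' hg' => hl g' (List.mem_cons_of_mem _ hg'))

theorem IsLayerOn.conjTranspose {𝒢 : Set ι → Prop} {A : Op ι} (h : IsLayerOn 𝒢 A) :
    IsLayerOn 𝒢 Aᴴ := by
  obtain ⟨l, hl, hp, rfl⟩ := h
  refine ⟨(l.map fun g => (g.1, g.2ᴴ)).reverse, ?_, ?_, ?_⟩
  · intro g hg
    rw [List.mem_reverse, List.mem_map] at hg
    obtain ⟨g, hg, rfl⟩ := hg
    exact ⟨(hl g hg).1, (hl g hg).2.star⟩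
  · rw [List.pairwise_reverse, List.pairwise_map]
    exact hp.imp fun h => h.symm
  · clear hl hp
    induction l with
    | nil => simp
    | cons g l ih => simp [Matrix.conjTranspose_mul, ih]

/-- Even gates with disjoint supports commute, so a layer may be reordered freely. -/
theorem IsLayerOn.split {𝒢 : Set ι → Prop} {A : Op ι} (h : IsLayerOn 𝒢 A) (p : Set ι → Prop) :
    ∃ B C, IsLayerOn (fun M => 𝒢 M ∧ p M) B ∧ IsLayerOn (fun M => 𝒢 M ∧ ¬ p M) C ∧
      A = B * C := by
  classical
  obtain ⟨l, hl, hp, rfl⟩ := h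
  refine ⟨((l.filter fun g => p g.1).map Prod.snd).prod,
    ((l.filter fun g => ¬ p g.1).map Prod.snd).prod,
    ⟨_, ?_, hp.filter _, rfl⟩, ⟨_, ?_, hp.filter _, rfl⟩, ?_⟩
  · intro g hg
    rw [List.mem_filter, decide_eq_true_iff] at hg
    exact ⟨⟨(hl g hg.1).1, hg.2⟩, (hl g hg.1).2⟩
  · intro g hg
    rw [List.mem_filter, decide_eq_true_iff] at hg
    exact ⟨⟨(hl g hg.1).1, hg.2⟩, (hl g hg.1).2⟩
  · rw [← List.prod_append, ← List.map_append]
    have hperm := (List.filter_append_perm (fun g : Set ι × Op ι => decide (p g.1)) l).symm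
    have e : (l.filter fun g => decide (¬ p g.1)) = l.filter fun g => !decide (p g.1) := by
      congr 1; ext g; simp
    rw [e]
    refine (hperm.map Prod.snd).prod_eq' ?_
    rw [List.pairwise_map]
    refine hp.imp_of_mem fun {g g'} hg hg' hd => ?_
    exact (hl g hg).2.commute hd (hl g' hg').2.mem

/-- The light cone of a layer. -/
theorem IsLayerOn.conj_mem {𝒢 : Set ι → Prop} {A : Op ι} (h : IsLayerOn 𝒢 A) {R R' : Set ι}
    (hR : R ⊆ R') (hG : ∀ M, 𝒢 M → Disjoint M R ∨ M ⊆ R') {x : Op ι} (hx : x ∈ modeAlgebra R) :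
    Aᴴ * x * A ∈ modeAlgebra R' := by
  -- Gates away from `R` commute with `x` and cancel; all the others are supported in `R'`.
  obtain ⟨B, C, hB, hC, rfl⟩ := h.split (fun M => Disjoint M R)
  have hBx : Commute B x := hB.commute (fun M hM => hM.2) hx
  have hB' := hB.isLocalUnitary (R := Set.univ) fun M _ => Set.subset_univ M
  have hC' := hC.isLocalUnitary (R := R') fun M hM => (hG M hM.1).resolve_left hM.2
  have e : (B * C)ᴴ * x * (B * C) = Cᴴ * x * C := by
    calc (B * C)ᴴ * x * (B * C) = Cᴴ * (Bᴴ * (x * B)) * C := by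
          rw [Matrix.conjTranspose_mul]; simp only [mul_assoc]
      _ = _ := by rw [← hBx.eq, hB'.cancel_left]
  rw [e]
  exact mul_mem (mul_mem hC'.star.mem (modeAlgebra_mono hR hx)) hC'.mem

theorem IsLayerOn.conj_mem' {𝒢 : Set ι → Prop} {A : Op ι} (h : IsLayerOn 𝒢 A) {R R' : Set ι}
    (hR : R ⊆ R') (hG : ∀ M, 𝒢 M → Disjoint M R ∨ M ⊆ R') {x : Op ι} (hx : x ∈ modeAlgebra R) :
    A * x * Aᴴ ∈ modeAlgebra R' := by
  simpa only [Matrix.conjTranspose_conjTranspose] using h.conjTranspose.conj_mem hR hG hx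

theorem IsCircuitOn.isLocalUnitary {𝒢 : Set ι → Prop} {D : ℕ} {U : Op ι}
    (h : IsCircuitOn 𝒢 D U) : IsLocalUnitary Set.univ U := by
  induction D generalizing U with
  | zero => obtain rfl : U = 1 := h; exact IsLocalUnitary.one _
  | succ D ih =>
    obtain ⟨V, A, hV, hA, rfl⟩ := h
    exact (ih hV).mul (hA.isLocalUnitary fun M _ => Set.subset_univ M)

theorem IsCircuitOn.conj_mem {𝒢 : Set ι → Prop} {D : ℕ} {U : Op ι} (h : IsCircuitOn 𝒢 D U)
    {R : Set ι} (hG : ∀ M, 𝒢 M → Disjoint M R ∨ M ⊆ R) {x : Op ι} (hx : x ∈ modeAlgebra R) :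
    Uᴴ * x * U ∈ modeAlgebra R ∧ U * x * Uᴴ ∈ modeAlgebra R := by
  induction D generalizing U x with
  | zero => obtain rfl : U = 1 := h; simpa using hx
  | succ D ih =>
    obtain ⟨V, A, hV, hA, rfl⟩ := h
    have e1 : (V * A)ᴴ * x * (V * A) = Aᴴ * (Vᴴ * x * V) * A := by
      rw [Matrix.conjTranspose_mul]; simp only [mul_assoc]
    have e2 : V * A * x * (V * A)ᴴ = V * (A * x * Aᴴ) * Vᴴ := by
      rw [Matrix.conjTranspose_mul]; simp only [mul_assoc]
    rw [e1, e2]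
    exact ⟨hA.conj_mem subset_rfl hG (ih hV hx).1, (ih hV (hA.conj_mem' subset_rfl hG hx)).2⟩

/-- Removing from a circuit the gates satisfying `p` amounts to the multiplication with a unitary
supported in the light cone of these gates. -/
theorem IsCircuitOn.cut {𝒢 : Set ι → Prop} {D : ℕ} {U : Op ι} (h : IsCircuitOn 𝒢 D U)
    (p : Set ι → Prop) (W : ℕ → Set ι) (hW : ∀ j < D, W j ⊆ W (j + 1))
    (hG : ∀ M, 𝒢 M → ∀ j < D, Disjoint M (W j) ∨ M ⊆ W (j + 1))
    (hp : ∀ M, 𝒢 M → p M → ∀ j < D, M ⊆ W (j + 1)) :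
    ∃ B k, IsCircuitOn (fun M => 𝒢 M ∧ ¬ p M) D B ∧ IsLocalUnitary (W D) k ∧ U = B * k := by
  induction D generalizing U with
  | zero => obtain rfl : U = 1 := h; exact ⟨1, 1, rfl, IsLocalUnitary.one _, by simp⟩
  | succ D ih =>
    obtain ⟨V, A, hV, hA, rfl⟩ := h
    obtain ⟨B, k, hB, hk, rfl⟩ := ih hV (fun j hj => hW j (by omega))
      (fun M hM j hj => hG M hM j (by omega)) (fun M hM hpM j hj => hp M hM hpM j (by omega))
    obtain ⟨A₁, A₂, hA₁, hA₂, rfl⟩ := hA.split (fun M => ¬ p M)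
    have h₁ := hA₁.isLocalUnitary (R := Set.univ) fun M _ => Set.subset_univ M
    have h₂ := hA₂.isLocalUnitary (R := W (D + 1)) fun M hM =>
      hp M hM.1 (not_not.mp hM.2) D (Nat.lt_succ_self D)
    have hk' := (h₁.star.mul (hk.mono (Set.subset_univ _))).mul h₁
    have hk'' : IsLocalUnitary (W (D + 1)) (A₁ᴴ * k * A₁) :=
      ⟨hA₁.conj_mem (hW D (Nat.lt_succ_self D)) (fun M hM => hG M hM.1 D (Nat.lt_succ_self D))
        hk.mem, hk'.left, hk'.right, hk'.even⟩
    -- The kept gates `A₁` are moved to the left of the correction `k`. The conjugation enlarges its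
    -- support by one layer of the light cone, and the removed gates `A₂` join the correction.
    refine ⟨B * A₁, A₁ᴴ * k * A₁ * A₂, ⟨B, A₁, hB, hA₁, rfl⟩, hk''.mul h₂, ?_⟩
    simp only [mul_assoc, h₁.cancel_right]

end Circuits

/-! ### Strips of columns of the ring and cuts of circuits. -/

section Columns

variable {ι : Type} [LinearOrder ι] [Fintype ι] {n : ℕ}

/-- The alternatives are a short path avoiding the seam between `n - 1` and `0`, or one crossing it
in either direction. -/
theorem ringDist_le {a b : Fin n} {r : ℕ} (h : ringDist a b ≤ r) :
    (a.val ≤ b.val + r ∧ b.val ≤ a.val + r) ∨ n + a.val ≤ b.val + r ∨ n + b.val ≤ a.val + r := by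
  have ha := a.isLt
  have hb := b.isLt
  unfold ringDist at h
  rcases lt_trichotomy a b with hab | rfl | hab
  · rw [Fin.coe_sub_iff_lt.mpr hab, Fin.coe_sub_iff_le.mpr hab.le] at h
    have : a.val < b.val := hab
    omega
  · left; omega
  · rw [Fin.coe_sub_iff_lt.mpr hab, Fin.coe_sub_iff_le.mpr hab.le] at h
    have : b.val < a.val := hab
    omega

/-- The modes in the columns `s, …, t - 1`. -/
def strip (pos : ι → Fin n) (s t : ℕ) : Set ι := {m | s ≤ (pos m).val ∧ (pos m).val < t}

theorem strip_mono {pos : ι → Fin n} {s t s' t' : ℕ} (h : s < t → s' ≤ s ∧ t ≤ t') :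
    strip pos s t ⊆ strip pos s' t' := by
  rintro m ⟨h1, h2⟩
  have := h (by omega)
  exact ⟨by omega, by omega⟩

theorem strip_disjoint {pos : ι → Fin n} {s t s' t' : ℕ}
    (h : s < t → s' < t' → t ≤ s' ∨ t' ≤ s) : Disjoint (strip pos s t) (strip pos s' t') := by
  rw [Set.disjoint_left]
  rintro m ⟨h1, h2⟩ ⟨h3, h4⟩
  have := h (by omega) (by omega)
  omega

theorem strip_union {pos : ι → Fin n} {s t u : ℕ} (h₁ : s ≤ t) (h₂ : t ≤ u) :
    strip pos s t ∪ strip pos t u = strip pos s u := by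
  ext m
  simp only [strip, Set.mem_union, Set.mem_ofPred_eq]
  omega

/-- Sets of modes with extension at most `r` around the ring. -/
def HasColumnRange (pos : ι → Fin n) (r : ℕ) (M : Set ι) : Prop :=
  ∀ a ∈ M, ∀ b ∈ M, ringDist (pos a) (pos b) ≤ r

/-- `M` has modes on both sides of the cut at `t`, within `r` columns of the cut. -/
def Crosses (pos : ι → Fin n) (r t : ℕ) (M : Set ι) : Prop :=
  ∃ a ∈ M, ∃ b ∈ M, t ≤ (pos a).val + r ∧ (pos a).val < t ∧ t ≤ (pos b).val ∧ (pos b).val < t + r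

/-- A set with points inside and outside the strip must cross one of its two ends. The margins `r`
at the seam exclude a connection around the ring. -/
theorem disjoint_or_subset_of_not_crosses {pos : ι → Fin n} {r s t : ℕ} {M : Set ι}
    (hM : HasColumnRange pos r M) (hs : ¬ Crosses pos r s M) (ht : ¬ Crosses pos r t M)
    (hrs : r ≤ s) (hrt : t + r ≤ n) : Disjoint M (strip pos s t) ∨ M ⊆ strip pos s t := by
  by_contra hcon
  rw [not_or, Set.not_disjoint_iff, Set.not_subset] at hcon
  obtain ⟨⟨a, haM, ha1, ha2⟩, b, hbM, hb⟩ := hcon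
  have hb' : (pos b).val < s ∨ t ≤ (pos b).val := by
    by_contra h
    exact hb ⟨by omega, by omega⟩
  have hbn := (pos b).isLt
  have hd := ringDist_le (hM a haM b hbM)
  rcases hb' with h | h
  · exact hs ⟨b, hbM, a, haM, by omega, by omega, by omega, by omega⟩
  · exact ht ⟨a, haM, b, hbM, by omega, by omega, by omega, by omega⟩

/-- The light cone starts as the empty strip at the cut and grows by `r` columns on either side with
each layer. The bounds on `t` and `n` prevent it from reaching around the ring. -/
theorem IsCircuitOn.cut_strip {pos : ι → Fin n} {𝒢 : Set ι → Prop} {r D t : ℕ} {U : Op ι}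
    (hU : IsCircuitOn 𝒢 D U) (hG : ∀ M, 𝒢 M → HasColumnRange pos r M) (hn : 4 * (r * D) ≤ n)
    (ht : r * D ≤ t) (ht' : t + r * D ≤ n) :
    ∃ B k, IsCircuitOn (fun M => 𝒢 M ∧ ¬ Crosses pos r t M) D B ∧
      IsLocalUnitary (strip pos (t - r * D) (t + r * D)) k ∧ U = B * k := by
  have hj : ∀ j < D, r * (j + 1) = r * j + r ∧ r * (j + 1) ≤ r * D ∧ r ≤ r * D := fun j hj =>
    ⟨by ring, Nat.mul_le_mul_left r hj, Nat.le_mul_of_pos_right r (by omega)⟩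
  refine hU.cut _ (fun j => strip pos (t - r * j) (t + r * j)) (fun j hjD => ?_)
    (fun M hM j hjD => ?_) (fun M hM hc j hjD => ?_)
  · obtain ⟨h1, h2, h3⟩ := hj j hjD
    exact strip_mono fun _ => by omega
  · obtain ⟨h1, h2, h3⟩ := hj j hjD
    rw [or_iff_not_imp_left, Set.not_disjoint_iff]
    rintro ⟨b, hbM, hb1, hb2⟩ a haM
    have hd := ringDist_le (hG M hM a haM b hbM)
    have := (pos a).isLt
    exact ⟨by omega, by omega⟩
  · obtain ⟨h1, h2, h3⟩ := hj j hjD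
    obtain ⟨a, haM, b, hbM, h4, h5, h6, h7⟩ := hc
    intro c hcM
    have hd := ringDist_le (hG M hM c hcM a haM)
    have hd' := ringDist_le (hG M hM c hcM b hbM)
    have := (pos c).isLt
    exact ⟨by omega, by omega⟩

/-- Local unitaries at given cuts which disentangle the strips between the cuts. -/
theorem exists_cuts {pos : ι → Fin n} {r D : ℕ} {U : Op ι} {ψ : State ι}
    (hU : IsCircuitOn (HasColumnRange pos r) D U) (hr : r ≤ r * D) (hn : 4 * (r * D) ≤ n)
    (hφ : ∀ s t, IsPureOn (strip pos s t) (U *ᵥ ψ)) {t₁ t₂ t₃ t₄ : ℕ}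
    (h₁ : r * D ≤ t₁ ∧ t₁ + r * D ≤ n) (h₂ : r * D ≤ t₂ ∧ t₂ + r * D ≤ n)
    (h₃ : r * D ≤ t₃ ∧ t₃ + r * D ≤ n) (h₄ : r * D ≤ t₄ ∧ t₄ + r * D ≤ n) :
    ∃ k₁ k₂ k₃ k₄ : Op ι,
      IsLocalUnitary (strip pos (t₁ - r * D) (t₁ + r * D)) k₁ ∧
      IsLocalUnitary (strip pos (t₂ - r * D) (t₂ + r * D)) k₂ ∧
      IsLocalUnitary (strip pos (t₃ - r * D) (t₃ + r * D)) k₃ ∧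
      IsLocalUnitary (strip pos (t₄ - r * D) (t₄ + r * D)) k₄ ∧
      ∀ s ∈ [t₁, t₂, t₃, t₄], ∀ t ∈ [t₁, t₂, t₃, t₄],
        IsPureOn (strip pos s t) ((k₁ * k₂ * k₃ * k₄) *ᵥ ψ) := by
  obtain ⟨B₄, k₄, hB₄, hk₄, rfl⟩ := hU.cut_strip (fun M hM => hM) hn h₄.1 h₄.2
  obtain ⟨B₃, k₃, hB₃, hk₃, rfl⟩ := hB₄.cut_strip (fun M hM => hM.1) hn h₃.1 h₃.2
  obtain ⟨B₂, k₂, hB₂, hk₂, rfl⟩ := hB₃.cut_strip (fun M hM => hM.1.1) hn h₂.1 h₂.2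
  obtain ⟨B, k₁, hB, hk₁, rfl⟩ := hB₂.cut_strip (fun M hM => hM.1.1.1) hn h₁.1 h₁.2
  refine ⟨k₁, k₂, k₃, k₄, hk₁, hk₂, hk₃, hk₄, fun s hs t ht => ?_⟩
  have hBu := hB.isLocalUnitary
  -- No remaining gate crosses any of the four cuts, so `B` normalises the algebra of every strip
  -- between them, and purity passes from the product state back through `B`.
  have hG : ∀ M : Set ι, ((((HasColumnRange pos r M ∧ ¬ Crosses pos r t₄ M) ∧
      ¬ Crosses pos r t₃ M) ∧ ¬ Crosses pos r t₂ M) ∧ ¬ Crosses pos r t₁ M) →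
      Disjoint M (strip pos s t) ∨ M ⊆ strip pos s t := by
    rintro M ⟨⟨⟨⟨hM, c₄⟩, c₃⟩, c₂⟩, c₁⟩
    simp only [List.mem_cons, List.not_mem_nil, or_false] at hs ht
    refine disjoint_or_subset_of_not_crosses hM ?_ ?_ ?_ ?_
    · rcases hs with rfl | rfl | rfl | rfl <;> assumption
    · rcases ht with rfl | rfl | rfl | rfl <;> assumption
    · omega
    · omega
  have h := (hφ s t).normalizer hBu.star
    (fun x hx => by rw [Matrix.conjTranspose_conjTranspose]; exact (hB.conj_mem hG hx).1)
    (fun x hx => by rw [Matrix.conjTranspose_conjTranspose]; exact (hB.conj_mem hG hx).2)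
  rw [Matrix.mulVec_mulVec] at h
  simpa only [mul_assoc, hBu.cancel_left] using h

end Columns

/-! ### Permutations of the ring: rotations and exchanges of blocks. -/

section Rotations

variable {n : ℕ}

/-- Rotation of the ring by one site. -/
def rot (n : ℕ) [NeZero n] : Equiv.Perm (Fin n) := Equiv.addRight 1

theorem rot_val [NeZero n] (x : Fin n) :
    (rot n x).val = if x.val + 1 < n then x.val + 1 else 0 := by
  have hx := x.isLt
  change (x + 1).val = _
  rw [Fin.val_add]
  split_ifs with h
  · rw [Fin.val_one', Nat.mod_eq_of_lt (show 1 < n by omega), Nat.mod_eq_of_lt h]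
  · rw [Fin.val_one', Nat.add_mod_mod, show x.val + 1 = n by omega, Nat.mod_self]

theorem rot_pow_val [NeZero n] {a : ℕ} (ha : a ≤ n) (x : Fin n) :
    ((rot n ^ a) x).val = if x.val + a < n then x.val + a else x.val + a - n := by
  have hx := x.isLt
  induction a with
  | zero => simp
  | succ a ih =>
    rw [pow_succ', Equiv.Perm.mul_apply, rot_val, ih (by omega)]
    split_ifs <;> omega

theorem rot_pow_self [NeZero n] : rot n ^ n = 1 := by
  ext x
  have hx := x.isLt
  rw [rot_pow_val le_rfl]
  simp

/-- The permutation exchanging the blocks `[s, t)` and `[s + a, t + a)`. -/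
def blockSwap (n s t a : ℕ) (h : t ≤ s + a) (h' : t + a ≤ n) : Equiv.Perm (Fin n) :=
  Function.Involutive.toPerm
    (fun x => ⟨if s ≤ x.val ∧ x.val < t then x.val + a else
      if s + a ≤ x.val ∧ x.val < t + a then x.val - a else x.val,
      by have hx := x.isLt; split_ifs <;> omega⟩) <| by
    intro x
    have hx := x.isLt
    ext
    dsimp only
    split_ifs <;> omega

theorem blockSwap_val {s t a : ℕ} (h : t ≤ s + a) (h' : t + a ≤ n) (x : Fin n) :
    (blockSwap n s t a h h' x).val = if s ≤ x.val ∧ x.val < t then x.val + a else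
      if s + a ≤ x.val ∧ x.val < t + a then x.val - a else x.val := rfl

/-- Cutting the ring and gluing gives two rings of lengths `a` and `b`. -/
theorem blockSwap_mul_rot_pow [NeZero n] {q a b : ℕ} (hab : a + b = n) (ha : q + 1 ≤ q + a)
    (hn : q + 1 + a ≤ n) : (blockSwap n q (q + 1) a ha hn * rot n) ^ (a * b) = 1 := by
  set ρ := blockSwap n q (q + 1) a ha hn * rot n with hρ
  have hval : ∀ x : Fin n, (ρ x).val =
      if x.val + 1 = q ∨ (q = 0 ∧ x.val + 1 = n) then q + a else
      if x.val + 1 = q + a then q else if x.val + 1 < n then x.val + 1 else 0 := by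
    intro x
    have hx := x.isLt
    rw [hρ, Equiv.Perm.mul_apply, blockSwap_val, rot_val]
    split_ifs <;> omega
  -- The orbit of `q` runs through [q, q + a) and then returns, as the exchange sends `q + a` back
  -- to `q`. The other columns form the orbit of `q + a`, of length `b`.
  have hA : ∀ j < a, ((ρ ^ j) ⟨q, by omega⟩).val = q + j := by
    intro j hj
    induction j with
    | zero => simp
    | succ j ih =>
      rw [pow_succ', Equiv.Perm.mul_apply, hval, ih (by omega)]
      split_ifs <;> omega
  have hB : ∀ j < b, ((ρ ^ j) ⟨q + a, by omega⟩).val =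
      if q + a + j < n then q + a + j else q + a + j - n := by
    intro j hj
    induction j with
    | zero => simp; omega
    | succ j ih =>
      rw [pow_succ', Equiv.Perm.mul_apply, hval, ih (by omega)]
      split_ifs <;> omega
  have hA' : (ρ ^ a) ⟨q, by omega⟩ = ⟨q, by omega⟩ := by
    ext
    obtain ⟨a', rfl⟩ : ∃ a', a = a' + 1 := ⟨a - 1, by omega⟩
    rw [pow_succ', Equiv.Perm.mul_apply, hval, hA a' (by omega)]
    split_ifs <;> simp <;> omega
  have hB' : (ρ ^ b) ⟨q + a, by omega⟩ = ⟨q + a, by omega⟩ := by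
    ext
    obtain ⟨b', rfl⟩ : ∃ b', b = b' + 1 := ⟨b - 1, by omega⟩
    rw [pow_succ', Equiv.Perm.mul_apply, hval, hB b' (by omega)]
    split_ifs <;> simp <;> omega
  have hfix : ∀ {y : Fin n} {m : ℕ} (k j : ℕ), (ρ ^ m) y = y →
      (ρ ^ (m * k)) ((ρ ^ j) y) = (ρ ^ j) y := by
    intro y m k j hy
    rw [← Equiv.Perm.mul_apply, ← pow_add, add_comm, pow_add, Equiv.Perm.mul_apply]
    congr 1
    rw [pow_mul]
    exact Function.IsFixedPt.perm_pow hy k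
  ext x
  have hx := x.isLt
  rw [Equiv.Perm.one_apply]
  by_cases h1 : q ≤ x.val ∧ x.val < q + a
  · have e : (ρ ^ (x.val - q)) ⟨q, by omega⟩ = x := by
      ext; rw [hA _ (by omega)]; omega
    rw [← e, hfix b _ hA']
  · have e : (ρ ^ (if q + a ≤ x.val then x.val - (q + a) else x.val + n - (q + a)))
        ⟨q + a, by omega⟩ = x := by
      ext; rw [hB _ (by split_ifs <;> omega)]; split_ifs <;> omega
    rw [← e, mul_comm a b, hfix a _ hB']

end Rotations

/-! ### The exchange of a block with its translate. -/

section ColumnActions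

variable {ι : Type} [LinearOrder ι] [Fintype ι] {n : ℕ}

/-- A partition of the modes into `n` columns, with an action of the permutations of the columns
by permutations of the modes. -/
structure ColumnAction (ι : Type) (n : ℕ) where
  /-- the column of a mode -/
  pos : ι → Fin n
  /-- the action on the modes -/
  perm : Equiv.Perm (Fin n) →* Equiv.Perm ι
  pos_perm : ∀ π m, pos (perm π m) = π (pos m)
  perm_congr : ∀ π π' m, π (pos m) = π' (pos m) → perm π m = perm π' m

namespace ColumnAction

variable (A : ColumnAction ι n)

theorem perm_eq_self {π : Equiv.Perm (Fin n)} {m : ι} (h : π (A.pos m) = A.pos m) :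
    A.perm π m = m := by
  rw [A.perm_congr π 1 m h, map_one]; rfl

theorem conjPerm_congr {π π' : Equiv.Perm (Fin n)} {M : Set ι} {x : Op ι}
    (hx : x ∈ modeAlgebra M) (h : ∀ m ∈ M, (π (A.pos m)).val = (π' (A.pos m)).val) :
    conjPerm (A.perm π) x = conjPerm (A.perm π') x :=
  LatticeFermion.conjPerm_congr (fun m hm => A.perm_congr _ _ m (Fin.ext (h m hm))) hx

theorem rot_mem_strip [NeZero n] {a s t : ℕ} (h : t + a ≤ n) (m : ι) :
    m ∈ strip A.pos s t ↔ A.perm (rot n ^ a) m ∈ strip A.pos (s + a) (t + a) := by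
  have hm := (A.pos m).isLt
  simp only [strip, Set.mem_ofPred_eq, A.pos_perm, rot_pow_val (show a ≤ n by omega)]
  split_ifs <;> omega

theorem isLocalUnitary_rot [NeZero n] {a s t : ℕ} (h : t + a ≤ n) {u : Op ι}
    (hu : IsLocalUnitary (strip A.pos s t) u) :
    IsLocalUnitary (strip A.pos (s + a) (t + a)) (conjPerm (A.perm (rot n ^ a)) u) :=
  hu.conjPerm fun m => (A.rot_mem_strip h m).mp

/-- The exchange of two blocks in translated states acts as a sign. -/
theorem exists_sign [NeZero n] {s t s' t' a : ℕ} (hs : s' ≤ s) (ht : t ≤ t') (hst : t' ≤ s' + a)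
    (hn : t' + a ≤ n) {Ψ : State ι} (hΨ : Ψ ≠ 0) {ζ : ℂ}
    (hT : permOp (A.perm (rot n ^ a)) *ᵥ Ψ = ζ • Ψ) {g : Op ι}
    (hg : IsLocalUnitary (strip A.pos s' t') g) (hpure : IsPureOn (strip A.pos s t) (g *ᵥ Ψ)) :
    ∃ ε : ℂ, ε * ε = 1 ∧
      (permOp (A.perm (blockSwap n s t a (by omega) (by omega))) *
        (g * conjPerm (A.perm (rot n ^ a)) g)) *ᵥ Ψ =
      ε • ((g * conjPerm (A.perm (rot n ^ a)) g) *ᵥ Ψ) := by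
  set S := A.perm (blockSwap n s t a (by omega) (by omega)) with hS
  set τ := A.perm (rot n ^ a) with hτ
  have hζ : ζ ≠ 0 := by
    rintro rfl
    rw [zero_smul] at hT
    exact permOp_mulVec_ne_zero hΨ hT
  obtain ⟨E, hE, hEψ⟩ := hpure
  have hE' : IsMinimal (strip A.pos (s + a) (t + a)) (conjPerm τ E) :=
    hE.conjPerm (A.rot_mem_strip (by omega))
  have hg' : IsLocalUnitary (strip A.pos (s' + a) (t' + a)) (conjPerm τ g) :=
    A.isLocalUnitary_rot hn hg
  have hd : Disjoint (strip A.pos s t) (strip A.pos (s + a) (t + a)) :=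
    strip_disjoint fun _ _ => by omega
  have hF := hE.mul hd hE'
  have cgg : Commute g (conjPerm τ g) := hg.commute (strip_disjoint fun _ _ => by omega) hg'.mem
  have cgE : Commute (conjPerm τ g) E := hg'.commute (strip_disjoint fun _ _ => by omega) hE.mem
  have cgE' : Commute g (conjPerm τ E) := hg.commute (strip_disjoint fun _ _ => by omega) hE'.mem
  set χ := (g * conjPerm τ g) *ᵥ Ψ with hχ
  have hχ0 : χ ≠ 0 := ((hg.mono (Set.subset_univ _)).mul
    (hg'.mono (Set.subset_univ _))).mulVec_ne_zero hΨ
  have hEχ : E *ᵥ χ = χ := by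
    rw [hχ, cgg.eq, Matrix.mulVec_mulVec, ← mul_assoc, ← cgE.eq, mul_assoc, ← Matrix.mulVec_mulVec,
      ← Matrix.mulVec_mulVec Ψ E, hEψ, Matrix.mulVec_mulVec]
  -- Since Ψ is a translation eigenvector, the translate of `g` disentangles the translated block.
  have hE'χ : conjPerm τ E *ᵥ χ = χ := by
    have h1 : conjPerm τ g *ᵥ Ψ = ζ⁻¹ • (permOp τ *ᵥ (g *ᵥ Ψ)) := by
      rw [permOp_mulVec_mulVec, hT, Matrix.mulVec_smul, smul_smul, inv_mul_cancel₀ hζ, one_smul]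
    have h2 : conjPerm τ E *ᵥ (conjPerm τ g *ᵥ Ψ) = conjPerm τ g *ᵥ Ψ := by
      rw [h1, Matrix.mulVec_smul, ← permOp_mulVec_mulVec, hEψ]
    rw [hχ, Matrix.mulVec_mulVec, ← mul_assoc, ← cgE'.eq, mul_assoc, ← Matrix.mulVec_mulVec,
      ← Matrix.mulVec_mulVec Ψ (conjPerm τ E), h2, Matrix.mulVec_mulVec]
  have hFχ : (E * conjPerm τ E) *ᵥ χ = χ := by rw [← Matrix.mulVec_mulVec, hE'χ, hEχ]
  have hSmem : permOp S ∈ modeAlgebra (strip A.pos s t ∪ strip A.pos (s + a) (t + a)) := by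
    refine permOp_mem fun m hm => A.perm_eq_self (Fin.ext ?_)
    simp only [strip, Set.mem_union, Set.mem_ofPred_eq] at hm
    rw [blockSwap_val]
    split_ifs <;> omega
  -- On the block the exchange agrees with the translation by `a`, hence it swaps the two
  -- projections and commutes with their product. Minimality then makes it act as a scalar, whose
  -- square is 1.
  have e1 : conjPerm S E = conjPerm τ E := by
    refine A.conjPerm_congr hE.mem fun m hm => ?_
    obtain ⟨h1, h2⟩ := hm
    rw [blockSwap_val, rot_pow_val (by omega)]
    split_ifs <;> omega
  have e2 : conjPerm S (conjPerm τ E) = E := by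
    rw [← conjPerm_comp, hS, hτ, ← map_mul]
    refine conjPerm_eq_self (fun m hm => A.perm_eq_self (Fin.ext ?_)) hE.mem
    obtain ⟨h1, h2⟩ := hm
    rw [Equiv.Perm.mul_apply, blockSwap_val, rot_pow_val (by omega)]
    split_ifs <;> omega
  have hcomm : permOp S * (E * conjPerm τ E) = E * conjPerm τ E * permOp S := by
    rw [permOp_mul_eq, conjPerm_mul, e1, e2, (commute_of_disjoint hd hE.mem hE.even hE'.mem).eq]
  obtain ⟨c, hc⟩ := hF.minimal _ hSmem
  have hSχ : permOp S *ᵥ χ = c • χ := by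
    have := congrArg (· *ᵥ χ) hc
    simp only [← hcomm] at this
    simpa only [← Matrix.mulVec_mulVec, hE'χ, hEχ, Matrix.smul_mulVec] using this
  refine ⟨c, ?_, ?_⟩
  · have hSS : permOp S * permOp S = (1 : Op ι) := by
      rw [← permOp_mul, hS, ← map_mul, show blockSwap n s t a (by omega) (by omega) *
        blockSwap n s t a (by omega) (by omega) = 1 from ?_, map_one, permOp_one]
      ext x
      rw [Equiv.Perm.mul_apply, blockSwap_val, blockSwap_val]
      have := x.isLt
      simp only [Equiv.Perm.one_apply]
      split_ifs <;> omega
    have h1 : (c * c) • χ = χ := by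
      rw [mul_smul, ← hSχ, ← Matrix.mulVec_smul, ← hSχ, Matrix.mulVec_mulVec, hSS,
        Matrix.one_mulVec]
    have h2 : (c * c - 1) • χ = 0 := by rw [sub_smul, h1, one_smul, sub_self]
    exact sub_eq_zero.mp ((smul_eq_zero.mp h2).resolve_right hχ0)
  · rw [← hSχ, hχ, Matrix.mulVec_mulVec]

end ColumnAction

end ColumnActions

namespace ColumnAction

/-! ### Gluing the ends of the cuts crosswise into two shorter rings. -/

section Gluing

variable {ι : Type} [LinearOrder ι] [Fintype ι] {n : ℕ} [NeZero n] (A : ColumnAction ι n)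

theorem permOp_pow_mulVec {σ : Equiv.Perm ι} {Ψ : State ι} {z : ℂ}
    (h : permOp σ *ᵥ Ψ = z • Ψ) (j : ℕ) : permOp (σ ^ j) *ᵥ Ψ = z ^ j • Ψ := by
  induction j with
  | zero => rw [pow_zero, permOp_one, Matrix.one_mulVec, pow_zero, one_smul]
  | succ j ih =>
    rw [pow_succ, permOp_mul, ← Matrix.mulVec_mulVec, h, Matrix.mulVec_smul, ih, smul_smul,
      ← pow_succ']

/-- The local operator cutting the ring by `k` and its translate by `a`, and gluing the ends
crosswise, where `S` exchanges the parts on one side of the cuts. -/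
def glue (S : Equiv.Perm (Fin n)) (a : ℕ) (k : Op ι) : Op ι :=
  conjPerm (A.perm S) (k * conjPerm (A.perm (rot n ^ a)) k)ᴴ *
    (k * conjPerm (A.perm (rot n ^ a)) k)

/-- The neighbourhood of radius `w` of the cuts at `p` and `p + a`. -/
def cutRegion (w p a : ℕ) : Set ι :=
  strip A.pos (p - w) (p + w) ∪ strip A.pos (p - w + a) (p + w + a)

variable {A}

theorem isLocalUnitary_pair {w p a : ℕ} (hn : p + w + a ≤ n) {k : Op ι}
    (hk : IsLocalUnitary (strip A.pos (p - w) (p + w)) k) :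
    IsLocalUnitary (A.cutRegion w p a) (k * conjPerm (A.perm (rot n ^ a)) k) :=
  (hk.mono Set.subset_union_left).mul ((A.isLocalUnitary_rot hn hk).mono Set.subset_union_right)

theorem isLocalUnitary_glue {w p a : ℕ} (hn : p + w + a ≤ n) {k : Op ι}
    (hk : IsLocalUnitary (strip A.pos (p - w) (p + w)) k) {S : Equiv.Perm (Fin n)}
    (hS : ∀ m ∈ A.cutRegion w p a, A.perm S m ∈ A.cutRegion w p a) :
    IsLocalUnitary (A.cutRegion w p a) (A.glue S a k) :=
  ((isLocalUnitary_pair hn hk).star.conjPerm hS).mul (isLocalUnitary_pair hn hk)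

theorem blockSwap_left {w p c a : ℕ} (hw : w ≤ p) (h₁ : p + 2 * w ≤ c) (h₂ : c + 2 * w ≤ p + a)
    (hn : c + w + a ≤ n) : ∀ m ∈ A.cutRegion w p a,
      A.perm (blockSwap n p c a (by omega) (by omega)) m ∈ A.cutRegion w p a := by
  intro m hm
  simp only [cutRegion, strip, Set.mem_union, Set.mem_ofPred_eq, A.pos_perm,
    blockSwap_val] at hm ⊢
  split_ifs <;> omega

theorem blockSwap_right {w p c a : ℕ} (hw : w ≤ p) (h₁ : p + 2 * w ≤ c) (h₂ : c + 2 * w ≤ p + a)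
    (hn : c + w + a ≤ n) : ∀ m ∈ A.cutRegion w c a,
      A.perm (blockSwap n p c a (by omega) (by omega)) m ∈ A.cutRegion w c a := by
  intro m hm
  simp only [cutRegion, strip, Set.mem_union, Set.mem_ofPred_eq, A.pos_perm,
    blockSwap_val] at hm ⊢
  split_ifs <;> omega

theorem cutRegion_disjoint {w p c a : ℕ} (hw : w ≤ p) (h₁ : p + 2 * w ≤ c)
    (h₂ : c + 2 * w ≤ p + a) : Disjoint (A.cutRegion w p a) (A.cutRegion w c a) := by
  simp only [cutRegion, Set.disjoint_union_left, Set.disjoint_union_right]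
  refine ⟨⟨?_, ?_⟩, ?_, ?_⟩ <;> exact strip_disjoint fun _ _ => by omega

/-- Cutting with `K * K'`, exchanging, and undoing the exchanged cuts gives back the exchange. As it
acts on the cut state by ε, only a local mismatch remains near each cut. -/
theorem permOp_mulVec_eq_of_pair {M M' : Set ι} {σ : Equiv.Perm ι} {K K' : Op ι}
    (hK : IsLocalUnitary M K) (hK' : IsLocalUnitary M' K')
    (hG : Commute (conjPerm σ Kᴴ * K) K') {Ψ : State ι} {ε : ℂ}
    (hS : (permOp σ * (K * K')) *ᵥ Ψ = ε • ((K * K') *ᵥ Ψ)) :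
    permOp σ *ᵥ Ψ = ε • ((conjPerm σ K'ᴴ * K') *ᵥ ((conjPerm σ Kᴴ * K) *ᵥ Ψ)) := by
  have h1 : permOp σ = conjPerm σ K'ᴴ * conjPerm σ Kᴴ * (permOp σ * (K * K')) := by
    rw [← conjPerm_mul, ← mul_assoc, ← permOp_mul_eq]
    simp only [mul_assoc, hK.cancel_left, hK'.left, mul_one]
  have h2 : conjPerm σ K'ᴴ * conjPerm σ Kᴴ * (K * K') =
      conjPerm σ K'ᴴ * K' * (conjPerm σ Kᴴ * K) := by
    rw [mul_assoc (conjPerm σ K'ᴴ) K', ← hG.eq]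
    simp only [mul_assoc]
  rw [h1, ← Matrix.mulVec_mulVec, hS, Matrix.mulVec_smul, Matrix.mulVec_mulVec, h2,
    Matrix.mulVec_mulVec]

/-- The exchange of two blocks acts on the state as a product of gluings at their ends. -/
theorem exists_swap_mulVec {w p c a : ℕ} (hw : w ≤ p) (h₁ : p + 2 * w ≤ c)
    (h₂ : c + 2 * w ≤ p + a) (hn : c + w + a ≤ n) {Ψ : State ι} (hΨ : Ψ ≠ 0) {z : ℂ}
    (hT : permOp (A.perm (rot n)) *ᵥ Ψ = z • Ψ) {k l : Op ι}
    (hk : IsLocalUnitary (strip A.pos (p - w) (p + w)) k)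
    (hl : IsLocalUnitary (strip A.pos (c - w) (c + w)) l)
    (hpure : IsPureOn (strip A.pos p c) ((k * l) *ᵥ Ψ)) :
    ∃ ε : ℂ, ε * ε = 1 ∧
      permOp (A.perm (blockSwap n p c a (by omega) (by omega))) *ᵥ Ψ =
        ε • (A.glue (blockSwap n p c a (by omega) (by omega)) a l *ᵥ
          (A.glue (blockSwap n p c a (by omega) (by omega)) a k *ᵥ Ψ)) := by
  have hTa : permOp (A.perm (rot n ^ a)) *ᵥ Ψ = z ^ a • Ψ := by
    rw [map_pow]; exact permOp_pow_mulVec hT a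
  obtain ⟨ε, hε, hS⟩ := A.exists_sign (s' := p - w) (t' := c + w) (s := p) (t := c) (by omega)
    (by omega) (by omega) (by omega) hΨ hTa
    ((hk.mono (strip_mono fun _ => by omega)).mul (hl.mono (strip_mono fun _ => by omega))) hpure
  refine ⟨ε, hε, ?_⟩
  have hL := blockSwap_left (A := A) hw h₁ h₂ hn
  set S := blockSwap n p c a (by omega) (by omega) with hSdef
  have hK := isLocalUnitary_pair (A := A) (a := a) (by omega) hk
  have hK' := isLocalUnitary_pair (A := A) (a := a) (by omega) hl
  have hG := isLocalUnitary_glue (A := A) (a := a) (by omega) hk hL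
  have hd := cutRegion_disjoint (A := A) hw h₁ h₂
  have hcomm : Commute l (conjPerm (A.perm (rot n ^ a)) k) :=
    hl.commute (strip_disjoint fun _ _ => by omega)
      (A.isLocalUnitary_rot (a := a) (by omega) hk).mem
  have hGK' := hG.commute hd hK'.mem
  have e : ∀ k' l' : Op ι, Commute l k' → k * l * (k' * l') = k * k' * (l * l') := by
    intro k' l' h
    rw [mul_assoc, ← mul_assoc l, h.eq]; simp only [mul_assoc]
  rw [conjPerm_mul, e _ _ hcomm] at hS
  exact permOp_mulVec_eq_of_pair hK hK' hGK' hS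

/-- If the blocks `[q, c)` and `[q + 1, c)` are disentangled by local unitaries, which at the left
ends are translates of each other, then the ring can be cut into two rings of lengths `a`, `b`. -/
theorem pow_eq_one_of_pure {w q c a b : ℕ} (hw : w ≤ q) (h₁ : q + 1 + 2 * w ≤ c)
    (h₂ : c + 2 * w ≤ q + a) (hn : c + w + a ≤ n) (hab : a + b = n) {Ψ : State ι} (hΨ : Ψ ≠ 0)
    {z : ℂ} (hT : permOp (A.perm (rot n)) *ᵥ Ψ = z • Ψ) {k l : Op ι}
    (hk : IsLocalUnitary (strip A.pos (q - w) (q + w)) k)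
    (hl : IsLocalUnitary (strip A.pos (c - w) (c + w)) l)
    (hpure : IsPureOn (strip A.pos q c) ((k * l) *ᵥ Ψ))
    (hpure' : IsPureOn (strip A.pos (q + 1) c) ((conjPerm (A.perm (rot n)) k * l) *ᵥ Ψ)) :
    (z ^ 2) ^ (a * b) = 1 := by
  set σ := rot n with hσ
  have hk' : IsLocalUnitary (strip A.pos (q + 1 - w) (q + 1 + w)) (conjPerm (A.perm σ) k) := by
    have := A.isLocalUnitary_rot (a := 1) (by omega) hk
    rw [pow_one] at this
    exact this.mono (strip_mono fun _ => by omega)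
  obtain ⟨ε₀, hε₀, hS₀⟩ := exists_swap_mulVec hw (by omega) h₂ hn hΨ hT hk hl hpure
  obtain ⟨ε₁, hε₁, hS₁⟩ := exists_swap_mulVec (p := q + 1) (by omega) h₁ (by omega) hn hΨ hT hk'
    hl hpure'
  have hL := blockSwap_left (A := A) (p := q) hw (by omega) h₂ hn
  have hR := blockSwap_right (A := A) (p := q) hw (by omega) h₂ hn
  set S₀ := blockSwap n q c a (by omega) (by omega) with hS₀def
  set S₁ := blockSwap n (q + 1) c a (by omega) (by omega) with hS₁def
  set τ := blockSwap n q (q + 1) a (by omega) (by omega) with hτdef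
  have hX := isLocalUnitary_glue (A := A) (a := a) (by omega) hl hR
  have hM := isLocalUnitary_glue (A := A) (a := a) (by omega) hk hL
  have hKq := isLocalUnitary_pair (A := A) (a := a) (by omega) hk
  have hKc := isLocalUnitary_pair (A := A) (a := a) (by omega) hl
  -- The two exchanges differ only in the columns `q` and `q + a`, which lie outside the
  -- neighbourhood of the right cuts.
  have hXX : A.glue S₁ a l = A.glue S₀ a l := by
    refine congrArg (· * (l * conjPerm (A.perm (rot n ^ a)) l)) ?_
    refine A.conjPerm_congr hKc.star.mem fun m hm => ?_
    simp only [cutRegion, strip, Set.mem_union, Set.mem_ofPred_eq] at hm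
    rw [blockSwap_val, blockSwap_val]
    split_ifs <;> omega
  -- Near the left cuts, rotating and then exchanging [q + 1, c) is the same as exchanging [q, c)
  -- and then rotating.
  have hMM : conjPerm (A.perm σ) (A.glue S₀ a k) = A.glue S₁ a (conjPerm (A.perm σ) k) := by
    unfold glue
    have e : conjPerm (A.perm σ) (k * conjPerm (A.perm (σ ^ a)) k) =
        conjPerm (A.perm σ) k * conjPerm (A.perm (σ ^ a)) (conjPerm (A.perm σ) k) := by
      rw [conjPerm_mul, ← conjPerm_comp, ← conjPerm_comp, ← map_mul, ← map_mul, ← pow_succ,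
        ← pow_succ']
    rw [conjPerm_mul, ← e]
    refine congrArg (· * conjPerm (A.perm σ) (k * conjPerm (A.perm (σ ^ a)) k)) ?_
    rw [← conjPerm_conjTranspose, ← conjPerm_comp, ← conjPerm_comp, ← map_mul, ← map_mul]
    refine A.conjPerm_congr hKq.star.mem fun m hm => ?_
    have := (A.pos m).isLt
    simp only [cutRegion, strip, Set.mem_union, Set.mem_ofPred_eq] at hm
    rw [Equiv.Perm.mul_apply, Equiv.Perm.mul_apply, rot_val, blockSwap_val, blockSwap_val, rot_val]
    split_ifs <;> omega
  have hττ : permOp (A.perm τ) * permOp (A.perm S₁) = (permOp (A.perm S₀) : Op ι) := by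
    rw [← permOp_mul, ← map_mul]
    refine congrArg (fun π => permOp (A.perm π)) ?_
    ext x
    have := x.isLt
    rw [Equiv.Perm.mul_apply, blockSwap_val, blockSwap_val, blockSwap_val]
    split_ifs <;> omega
  have hτX : conjPerm (A.perm τ) (A.glue S₀ a l) = A.glue S₀ a l := by
    refine conjPerm_eq_self (fun m hm => A.perm_eq_self (Fin.ext ?_)) hX.mem
    simp only [cutRegion, strip, Set.mem_union, Set.mem_ofPred_eq] at hm
    rw [blockSwap_val]
    split_ifs <;> omega
  set X := A.glue S₀ a l
  set M := A.glue S₀ a k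
  rw [hXX, ← hMM] at hS₁
  set ψ := M *ᵥ Ψ with hψ
  have hψ0 : ψ ≠ 0 := hM.mulVec_ne_zero hΨ
  have hσψ : permOp (A.perm σ) *ᵥ ψ = z • (conjPerm (A.perm σ) M *ᵥ Ψ) := by
    rw [hψ, permOp_mulVec_mulVec, hT, Matrix.mulVec_smul]
  -- As τ turns the second exchange into the first and commutes with `X`, the right gluing cancels
  -- between the two identities.
  have key : permOp (A.perm τ) *ᵥ (conjPerm (A.perm σ) M *ᵥ Ψ) = (ε₁ * ε₀) • ψ := by
    have h1 := congrArg (permOp (A.perm τ) *ᵥ ·) hS₁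
    simp only [Matrix.mulVec_smul] at h1
    rw [Matrix.mulVec_mulVec, hττ, hS₀, permOp_mulVec_mulVec, hτX] at h1
    have h2 := congrArg (Xᴴ *ᵥ ·) h1
    simp only [Matrix.mulVec_smul] at h2
    rw [Matrix.mulVec_mulVec, hX.left, Matrix.one_mulVec, Matrix.mulVec_mulVec, hX.left,
      Matrix.one_mulVec] at h2
    rw [mul_smul, h2, smul_smul, hε₁, one_smul]
  have hρ : permOp (A.perm (τ * σ)) *ᵥ ψ = (z * (ε₁ * ε₀)) • ψ := by
    rw [map_mul, permOp_mul, ← Matrix.mulVec_mulVec, hσψ, Matrix.mulVec_smul, key, smul_smul]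
  have hpow := permOp_pow_mulVec hρ (a * b)
  rw [← map_pow, blockSwap_mul_rot_pow hab, map_one, permOp_one, Matrix.one_mulVec] at hpow
  have h3 : (z * (ε₁ * ε₀)) ^ (a * b) = 1 := by
    have h' : ((z * (ε₁ * ε₀)) ^ (a * b) - 1) • ψ = 0 := by
      rw [sub_smul, ← hpow, one_smul, sub_self]
    exact sub_eq_zero.mp ((smul_eq_zero.mp h').resolve_right hψ0)
  -- The two signs are not determined, so only the square of `z` is controlled.
  have h4 : (z * (ε₁ * ε₀)) ^ 2 = z ^ 2 := by
    calc (z * (ε₁ * ε₀)) ^ 2 = z ^ 2 * ((ε₁ * ε₁) * (ε₀ * ε₀)) := by ring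
      _ = z ^ 2 := by rw [hε₁, hε₀, mul_one, mul_one]
  rw [← h4, ← pow_mul, mul_comm 2, pow_mul, h3, one_pow]

end Gluing

end ColumnAction

/-! ### Fermion parity of regions. -/

section Parity

variable {ι : Type} [LinearOrder ι] [Fintype ι]

/-- The fermion parity of the modes in `M`. -/
def parityOn (M : Finset ι) : Op ι := Matrix.diagonal fun s => (-1) ^ (s ∩ M).card

theorem parityOn_mulVec (M : Finset ι) (ψ : State ι) (s : Finset ι) :
    (parityOn M *ᵥ ψ) s = (-1) ^ (s ∩ M).card * ψ s := by
  simp [parityOn, Matrix.mulVec_diagonal]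

theorem parityOn_sq (M : Finset ι) : parityOn M * parityOn M = 1 := by
  simp [parityOn, Matrix.diagonal_mul_diagonal, ← mul_pow]

theorem commute_parityOn_parity (M : Finset ι) : Commute (parityOn M) parity :=
  Matrix.commute_diagonal _ _

theorem parityOn_mem (M : Finset ι) : parityOn M ∈ modeAlgebra (M : Set ι) := by
  induction M using Finset.induction_on with
  | empty =>
    have : parityOn (∅ : Finset ι) = 1 := by simp [parityOn]
    rw [this]; exact one_mem _
  | insert i M hi ih =>
    have e : parityOn (insert i M) =
        (1 - (2 : ℂ) • ((annihilate i)ᴴ * annihilate i)) * parityOn M := by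
      apply op_ext; intro ψ; ext s
      rw [← Matrix.mulVec_mulVec, Matrix.sub_mulVec, Matrix.one_mulVec, Matrix.smul_mulVec,
        ← Matrix.mulVec_mulVec, Pi.sub_apply, Pi.smul_apply, create_mulVec, annihilate_mulVec,
        parityOn_mulVec, parityOn_mulVec]
      by_cases hs : i ∈ s
      · rw [if_pos hs, if_neg (Finset.notMem_erase i s), Finset.insert_erase hs, jwSign_erase hs,
          if_neg (lt_irrefl i), one_mul, ← mul_assoc, jwSign_mul_self, parityOn_mulVec,
          Finset.inter_insert_of_mem hs, Finset.card_insert_of_notMem (by simp [hi]), pow_succ]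
        simp only [smul_eq_mul]; ring
      · rw [if_neg hs, Finset.inter_insert_of_notMem hs]; simp
    rw [e]
    refine mul_mem (sub_mem (one_mem _) (Subalgebra.smul_mem _ (mul_mem ?_ ?_) _))
      (modeAlgebra_mono (by simp) ih)
    · exact create_mem (by simp)
    · exact annihilate_mem (by simp)

theorem conjPerm_parityOn {σ : Equiv.Perm ι} {M M' : Finset ι} (h : ∀ m, m ∈ M ↔ σ m ∈ M') :
    conjPerm σ (parityOn M) = parityOn M' := by
  have e : permOp σ * parityOn M = parityOn M' * permOp σ := by
    apply op_ext; intro ψ; ext s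
    rw [← Matrix.mulVec_mulVec, ← Matrix.mulVec_mulVec, permOp_mulVec, parityOn_mulVec,
      parityOn_mulVec, permOp_mulVec]
    have : (s.map σ.symm.toEmbedding ∩ M).card = (s ∩ M').card := by
      rw [← Finset.card_map σ.toEmbedding, Finset.map_inter, map_map_symm]
      refine congrArg Finset.card ?_
      ext m
      simp only [Finset.mem_inter, Finset.mem_map_equiv, h, Equiv.apply_symm_apply]
    rw [this]; ring
  rw [conjPerm, e, mul_assoc, permOp_mul_conjTranspose, mul_one]

theorem parityOn_mul_compl {M M' : Finset ι} (h : ∀ m, m ∈ M' ↔ m ∉ M) :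
    parityOn M * parityOn M' = parity := by
  rw [parityOn, parityOn, Matrix.diagonal_mul_diagonal, parity]
  congr 1
  ext s
  rw [← pow_add]
  congr 1
  rw [← Finset.card_union_of_disjoint]
  · congr 1; ext m; simp only [Finset.mem_union, Finset.mem_inter, h]; tauto
  · rw [Finset.disjoint_left]; intro m hm hm'
    simp only [Finset.mem_inter, h] at hm hm'
    exact hm'.2 hm.2

/-- A state which is invariant under the exchange of two complementary regions and unentangled
between them has even parity. -/
theorem parity_mulVec_of_pure {R R' : Set ι} (hR : ∀ m, m ∈ R' ↔ m ∉ R) {σ : Equiv.Perm ι}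
    (hσ : ∀ m, m ∈ R ↔ σ m ∈ R') {χ : State ι} (hχ : χ ≠ 0) {ζ : ℂ}
    (hT : permOp σ *ᵥ χ = ζ • χ) (hpure : IsPureOn R χ) : parity *ᵥ χ = χ := by
  classical
  have hζ : ζ ≠ 0 := by
    rintro rfl
    rw [zero_smul] at hT
    exact permOp_mulVec_ne_zero hχ hT
  set M : Finset ι := Finset.univ.filter (· ∈ R) with hM
  set M' : Finset ι := Finset.univ.filter (· ∈ R') with hM'
  have hMR : (M : Set ι) = R := by ext; simp [hM]
  have hMR' : (M' : Set ι) = R' := by ext; simp [hM']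
  have hP : parityOn M ∈ modeAlgebra R := hMR ▸ parityOn_mem M
  have hP' : parityOn M' ∈ modeAlgebra R' := hMR' ▸ parityOn_mem M'
  have hconj : conjPerm σ (parityOn M) = parityOn M' :=
    conjPerm_parityOn fun m => by simp [hM, hM', hσ]
  have hprod : parityOn M * parityOn M' = (parity : Op ι) :=
    parityOn_mul_compl fun m => by simp [hM, hM', hR]
  obtain ⟨E, hE, hEχ⟩ := hpure
  have hd : Disjoint R' R := Set.disjoint_left.mpr fun m hm => (hR m).mp hm
  have hPE' : Commute (parityOn M') E :=
    commute_of_disjoint hd hP' (commute_parityOn_parity M') hE.mem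
  -- The parity of `R` is the total parity times that of the complement; `E` commutes with the
  -- former because it is even, with the latter by disjointness.
  have hPE : parityOn M * E = E * parityOn M := by
    have e : parityOn M = parity * parityOn M' := by
      rw [← hprod, mul_assoc, parityOn_sq, mul_one]
    rw [e, mul_assoc, hPE'.eq, ← mul_assoc, ← hE.even.eq, mul_assoc]
  obtain ⟨c, hc⟩ := hE.minimal _ hP
  have h1 : parityOn M *ᵥ χ = c • χ := by
    have := congrArg (· *ᵥ χ) hc
    simp only [← hPE] at this
    simpa only [← Matrix.mulVec_mulVec, hEχ, Matrix.smul_mulVec] using this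
  -- The exchange carries the parity of one region to that of the other, so both have the same value
  -- and the total parity is its square.
  have h2 : parityOn M' *ᵥ χ = c • χ := by
    have h := permOp_mulVec_mulVec σ (parityOn M) χ
    rw [hconj, hT, h1, Matrix.mulVec_smul, Matrix.mulVec_smul, hT, smul_comm] at h
    exact (smul_right_injective _ hζ h).symm
  have h3 : (c * c) • χ = χ := by
    rw [mul_smul, ← h1, ← Matrix.mulVec_smul, ← h1, Matrix.mulVec_mulVec, parityOn_sq,
      Matrix.one_mulVec]
  rw [← hprod, ← Matrix.mulVec_mulVec, h2, Matrix.mulVec_smul, h1, smul_smul, h3]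

end Parity

/-! ### Momentum and parity of states disentangled by a circuit on the ring. -/

namespace ColumnAction

section Main

variable {ι : Type} [LinearOrder ι] [Fintype ι] {n : ℕ} [NeZero n] {A : ColumnAction ι n}

/-- Momentum of states which can be disentangled. -/
theorem pow_eq_one_of_circuit {r D a b : ℕ} {U : Op ι} {Ψ : State ι} {z : ℂ} (hΨ : Ψ ≠ 0)
    (hT : permOp (A.perm (rot n)) *ᵥ Ψ = z • Ψ) (hU : IsCircuitOn (HasColumnRange A.pos r) D U)
    (hr : r ≤ r * D) (hφ : ∀ s t, IsPureOn (strip A.pos s t) (U *ᵥ Ψ)) (hab : a + b = n)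
    (ha : 9 * (r * D) + 1 ≤ a) (hb : 9 * (r * D) + 1 ≤ b) : (z ^ 2) ^ (a * b) = 1 := by
  -- For `r * D > 0` one spare column separates the supports of `k₂` and `k₃`. For `r * D = 0` the
  -- supports are empty, and no column may be wasted because `a = b = 1` is admitted.
  obtain ⟨v, hv⟩ : ∃ v, (r * D = 0 ∧ v = 0) ∨ (1 ≤ r * D ∧ v = 1) := by
    rcases Nat.eq_zero_or_pos (r * D) with h | h
    · exact ⟨0, Or.inl ⟨h, rfl⟩⟩
    · exact ⟨1, Or.inr ⟨h, rfl⟩⟩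
  -- Consecutive cuts are at least 2rD apart to keep the supports disjoint. The additional column at
  -- the second and fourth cuts makes room for the translates of `k₁` and `k₃` by one column.
  have hcuts := exists_cuts hU hr (by omega) hφ (t₁ := r * D) (t₂ := 3 * (r * D) + 1)
    (t₃ := 5 * (r * D) + v) (t₄ := 7 * (r * D) + v + 1) (by omega) (by omega) (by omega)
    (by omega)
  obtain ⟨k₁, k₂, k₃, k₄, hk₁, hk₂, hk₃, hk₄, hpure⟩ := hcuts
  generalize r * D = w at *
  have c₁₂ : Commute k₁ k₂ := hk₁.commute (strip_disjoint fun _ _ => by omega) hk₂.mem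
  have c₁₃ : Commute k₁ k₃ := hk₁.commute (strip_disjoint fun _ _ => by omega) hk₃.mem
  have c₂₃ : Commute k₂ k₃ := hk₂.commute (strip_disjoint fun _ _ => by omega) hk₃.mem
  have c₁₄ : Commute k₁ k₄ := hk₁.commute (strip_disjoint fun _ _ => by omega) hk₄.mem
  have c₂₄ : Commute k₂ k₄ := hk₂.commute (strip_disjoint fun _ _ => by omega) hk₄.mem
  have c₃₄ : Commute k₃ k₄ := hk₃.commute (strip_disjoint fun _ _ => by omega) hk₄.mem
  have H₁₄ : IsPureOn (strip A.pos w (7 * w + v + 1)) ((k₁ * k₄) *ᵥ Ψ) := by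
    have h := hpure w (by simp) (7 * w + v + 1) (by simp)
    have e : k₁ * k₂ * k₃ * k₄ = k₂ * (k₃ * (k₁ * k₄)) := by
      rw [c₁₂.eq, mul_assoc k₂, c₁₃.eq]; simp only [mul_assoc]
    rw [e, ← Matrix.mulVec_mulVec, ← Matrix.mulVec_mulVec] at h
    exact (h.of_mulVec_inside hk₂ (strip_mono fun _ => by omega)).of_mulVec_inside hk₃
      (strip_mono fun _ => by omega)
  have H₂₄ : IsPureOn (strip A.pos (3 * w + 1) (7 * w + v + 1)) ((k₂ * k₄) *ᵥ Ψ) := by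
    have h := hpure (3 * w + 1) (by simp) (7 * w + v + 1) (by simp)
    have e : k₁ * k₂ * k₃ * k₄ = k₁ * (k₃ * (k₂ * k₄)) := by
      rw [mul_assoc k₁, c₂₃.eq]; simp only [mul_assoc]
    rw [e, ← Matrix.mulVec_mulVec, ← Matrix.mulVec_mulVec] at h
    exact (h.of_mulVec_outside hk₁ (strip_disjoint fun _ _ => by omega)).of_mulVec_inside hk₃
      (strip_mono fun _ => by omega)
  have H₁₃ : IsPureOn (strip A.pos w (5 * w + v)) ((k₁ * k₃) *ᵥ Ψ) := by
    have h := hpure w (by simp) (5 * w + v) (by simp)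
    have e : k₁ * k₂ * k₃ * k₄ = k₂ * (k₄ * (k₁ * k₃)) := by
      rw [c₁₂.eq, mul_assoc, mul_assoc, ((c₁₄.mul_left c₃₄).eq).symm]; simp only [mul_assoc]
    rw [e, ← Matrix.mulVec_mulVec, ← Matrix.mulVec_mulVec] at h
    exact (h.of_mulVec_inside hk₂ (strip_mono fun _ => by omega)).of_mulVec_outside hk₄
      (strip_disjoint fun _ _ => by omega)
  have hz : z ≠ 0 := by
    rintro rfl
    rw [zero_smul] at hT
    exact permOp_mulVec_ne_zero hΨ hT
  have loc : ∀ {s t : ℕ} {u : Op ι}, t + 1 ≤ n → IsLocalUnitary (strip A.pos s t) u →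
      IsLocalUnitary (strip A.pos (s + 1) (t + 1)) (conjPerm (A.perm (rot n)) u) := by
    intro s t u ht hu
    have := A.isLocalUnitary_rot (a := 1) ht hu
    rwa [pow_one] at this
  have H₁₃' : IsPureOn (strip A.pos (w + 1) (5 * w + v + 1))
      ((conjPerm (A.perm (rot n)) k₁ * conjPerm (A.perm (rot n)) k₃) *ᵥ Ψ) := by
    have hmem := A.rot_mem_strip (a := 1) (s := w) (t := 5 * w + v) (by omega)
    rw [pow_one] at hmem
    have h := (H₁₃.permOp_mulVec hmem).smul z⁻¹
    rwa [permOp_mulVec_mulVec, hT, Matrix.mulVec_smul, smul_smul, inv_mul_cancel₀ hz, one_smul,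
      conjPerm_mul] at h
  have hk₁' := loc (by omega) hk₁
  have hk₃' := loc (by omega) hk₃
  -- The translated strip from `H₁₃` supplies the left end, `H₂₄` the right end. They overlap in [3w
  -- + 1, 5w + v + 1), where the intermediate cuts are removed again.
  have hmix : IsPureOn (strip A.pos (w + 1) (7 * w + v + 1))
      ((conjPerm (A.perm (rot n)) k₁ * k₄) *ᵥ Ψ) := by
    have e12 := strip_union (pos := A.pos) (s := w + 1) (t := 3 * w + 1) (u := 5 * w + v + 1)
      (by omega) (by omega)
    have e23 := strip_union (pos := A.pos) (s := 3 * w + 1) (t := 5 * w + v + 1)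
      (u := 7 * w + v + 1) (by omega) (by omega)
    have e123 := strip_union (pos := A.pos) (s := w + 1) (t := 3 * w + 1)
      (u := 7 * w + v + 1) (by omega) (by omega)
    have := IsPureOn.mix (R₁ := strip A.pos (w + 1) (3 * w + 1))
      (R₂ := strip A.pos (3 * w + 1) (5 * w + v + 1))
      (R₃ := strip A.pos (5 * w + v + 1) (7 * w + v + 1)) hΨ
      (strip_disjoint fun _ _ => by omega) (strip_disjoint fun _ _ => by omega)
      (strip_disjoint fun _ _ => by omega) hk₁' hk₂ hk₃' hk₄
      (by rw [e23]; exact strip_disjoint fun _ _ => by omega)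
      (by rw [e12]; exact strip_disjoint fun _ _ => by omega)
      (by rw [e12]; exact strip_mono fun _ => by omega)
      (by rw [e23]; exact strip_mono fun _ => by omega)
      (strip_disjoint fun _ _ => by omega) (strip_disjoint fun _ _ => by omega)
      (strip_disjoint fun _ _ => by omega) (strip_disjoint fun _ _ => by omega)
      (by rw [e12]; exact H₁₃') (by rw [e23]; exact H₂₄)
    rwa [e23, e123] at this
  -- The margins require `8 * w + v + 1` to be at most `a` and `b`; this follows from `9 * w + 1`
  -- because `v ≤ w`.
  exact pow_eq_one_of_pure (w := w) (q := w) (c := 7 * w + v + 1) le_rfl (by omega) (by omega)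
    (by omega) hab hΨ hT hk₁ hk₄ H₁₄ hmix

/-- Parity of translation invariant states which can be disentangled. -/
theorem parity_of_circuit {r D a : ℕ} {U : Op ι} {Ψ : State ι} {z : ℂ} (hΨ : Ψ ≠ 0)
    (hT : permOp (A.perm (rot n)) *ᵥ Ψ = z • Ψ) (hU : IsCircuitOn (HasColumnRange A.pos r) D U)
    (hr : r ≤ r * D) (hφ : ∀ s t, IsPureOn (strip A.pos s t) (U *ᵥ Ψ)) (ha : a + a = n)
    (hw : 12 * (r * D) ≤ a) : parity *ᵥ Ψ ≠ -Ψ := by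
  intro hodd
  have hn := NeZero.pos n
  -- The second cut and its translate by `a` will bound a half ring; the first and third are
  -- auxiliary. The fourth is not needed and is removed in both uses.
  have hcuts := exists_cuts hU hr (by omega) hφ (t₁ := r * D) (t₂ := 5 * (r * D))
    (t₃ := 3 * (r * D) + a) (t₄ := 7 * (r * D)) (by omega) (by omega) (by omega) (by omega)
  obtain ⟨k₁, k₂, k₃, k₄, hk₁, hk₂, hk₃, hk₄, hpure⟩ := hcuts
  generalize r * D = w at *
  have c₁₂ : Commute k₁ k₂ := hk₁.commute (strip_disjoint fun _ _ => by omega) hk₂.mem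
  have c₁₃ : Commute k₁ k₃ := hk₁.commute (strip_disjoint fun _ _ => by omega) hk₃.mem
  have c₁₄ : Commute k₁ k₄ := hk₁.commute (strip_disjoint fun _ _ => by omega) hk₄.mem
  have c₂₃ : Commute k₂ k₃ := hk₂.commute (strip_disjoint fun _ _ => by omega) hk₃.mem
  have c₂₄ : Commute k₂ k₄ := hk₂.commute (strip_disjoint fun _ _ => by omega) hk₄.mem
  have c₃₄ : Commute k₃ k₄ := hk₃.commute (strip_disjoint fun _ _ => by omega) hk₄.mem
  have H₂₃ : IsPureOn (strip A.pos (5 * w) (3 * w + a)) ((k₂ * k₃) *ᵥ Ψ) := by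
    have h := hpure (5 * w) (by simp) (3 * w + a) (by simp)
    have e : k₁ * k₂ * k₃ * k₄ = k₁ * (k₄ * (k₂ * k₃)) := by
      rw [mul_assoc k₁, mul_assoc k₁, (c₂₄.mul_left c₃₄).eq]
    rw [e, ← Matrix.mulVec_mulVec, ← Matrix.mulVec_mulVec] at h
    exact (h.of_mulVec_outside hk₁ (strip_disjoint fun _ _ => by omega)).of_mulVec_inside hk₄
      (strip_mono fun _ => by omega)
  have H₁₂ : IsPureOn (strip A.pos w (5 * w)) ((k₁ * k₂) *ᵥ Ψ) := by
    have h := hpure w (by simp) (5 * w) (by simp)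
    have e : k₁ * k₂ * k₃ * k₄ = k₃ * (k₄ * (k₁ * k₂)) := by
      rw [mul_assoc (k₁ * k₂), ((c₁₃.mul_left c₂₃).mul_right (c₁₄.mul_left c₂₄)).eq, mul_assoc]
    rw [e, ← Matrix.mulVec_mulVec, ← Matrix.mulVec_mulVec] at h
    exact (h.of_mulVec_outside hk₃ (strip_disjoint fun _ _ => by omega)).of_mulVec_outside hk₄
      (strip_disjoint fun _ _ => by omega)
  have hTa : permOp (A.perm (rot n ^ a)) *ᵥ Ψ = z ^ a • Ψ := by
    rw [map_pow]; exact permOp_pow_mulVec hT a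
  have hza : z ^ a ≠ 0 := by
    intro h0
    rw [h0, zero_smul] at hTa
    exact permOp_mulVec_ne_zero hΨ hTa
  set τ := A.perm (rot n ^ a) with hτ
  have H₁₂' : IsPureOn (strip A.pos (w + a) (5 * w + a))
      ((conjPerm τ k₁ * conjPerm τ k₂) *ᵥ Ψ) := by
    have h := (H₁₂.permOp_mulVec (A.rot_mem_strip (a := a) (by omega))).smul (z ^ a)⁻¹
    rwa [permOp_mulVec_mulVec, hTa, Matrix.mulVec_smul, smul_smul, inv_mul_cancel₀ hza, one_smul,
      conjPerm_mul] at h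
  have hk₁' := A.isLocalUnitary_rot (a := a) (by omega) hk₁
  have hk₂' := A.isLocalUnitary_rot (a := a) (by omega) hk₂
  -- The left end comes from `H₂₃`, the right end from the translate of `H₁₂`, with overlap [w + a,
  -- 3w + a).
  have hmix : IsPureOn (strip A.pos (5 * w) (5 * w + a)) ((k₂ * conjPerm τ k₂) *ᵥ Ψ) := by
    have e12 := strip_union (pos := A.pos) (s := 5 * w) (t := w + a) (u := 3 * w + a)
      (by omega) (by omega)
    have e23 := strip_union (pos := A.pos) (s := w + a) (t := 3 * w + a) (u := 5 * w + a)
      (by omega) (by omega)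
    have e123 := strip_union (pos := A.pos) (s := 5 * w) (t := w + a) (u := 5 * w + a)
      (by omega) (by omega)
    have := IsPureOn.mix (R₁ := strip A.pos (5 * w) (w + a))
      (R₂ := strip A.pos (w + a) (3 * w + a))
      (R₃ := strip A.pos (3 * w + a) (5 * w + a)) hΨ
      (strip_disjoint fun _ _ => by omega) (strip_disjoint fun _ _ => by omega)
      (strip_disjoint fun _ _ => by omega) hk₂ hk₁' hk₃ hk₂'
      (by rw [e23]; exact strip_disjoint fun _ _ => by omega)
      (by rw [e12]; exact strip_disjoint fun _ _ => by omega)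
      (by rw [e12]; exact strip_mono fun _ => by omega)
      (by rw [e23]; exact strip_mono fun _ => by omega)
      (strip_disjoint fun _ _ => by omega) (strip_disjoint fun _ _ => by omega)
      (strip_disjoint fun _ _ => by omega) (strip_disjoint fun _ _ => by omega)
      (by rw [e12]; exact H₂₃) (by rw [e23]; exact H₁₂')
    rwa [e23, e123] at this
  have hττ : τ * τ = 1 := by
    rw [hτ, ← map_mul, ← pow_add, ha, rot_pow_self, map_one]
  have ckk : Commute k₂ (conjPerm τ k₂) :=
    hk₂.commute (strip_disjoint fun _ _ => by omega) hk₂'.mem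
  have hK : IsLocalUnitary Set.univ (k₂ * conjPerm τ k₂) :=
    (hk₂.mono (Set.subset_univ _)).mul (hk₂'.mono (Set.subset_univ _))
  -- As τ is an involution, it exchanges the two cutting unitaries, so the cut state is still an
  -- eigenvector of the half-turn.
  have hconj : conjPerm τ (k₂ * conjPerm τ k₂) = k₂ * conjPerm τ k₂ := by
    rw [conjPerm_mul, ← conjPerm_comp, hττ, conjPerm_refl, ckk.eq]
  have hTχ : permOp τ *ᵥ ((k₂ * conjPerm τ k₂) *ᵥ Ψ) =
      z ^ a • ((k₂ * conjPerm τ k₂) *ᵥ Ψ) := by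
    rw [permOp_mulVec_mulVec, hconj, hTa, Matrix.mulVec_smul]
  have heven := parity_mulVec_of_pure (R' := (strip A.pos (5 * w) (5 * w + a))ᶜ)
    (fun m => Iff.rfl) (σ := τ) (fun m => by
      have hm := (A.pos m).isLt
      simp only [strip, Set.mem_compl_iff, Set.mem_ofPred_eq, hτ, A.pos_perm,
        rot_pow_val (show a ≤ n by omega)]
      split_ifs <;> omega) (hK.mulVec_ne_zero hΨ) hTχ hmix
  -- Even unitaries preserve the odd parity of Ψ, so the cut state would be both even and odd.
  rw [Matrix.mulVec_mulVec, ← hK.even.eq, ← Matrix.mulVec_mulVec, hodd, Matrix.mulVec_neg] at heven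
  have h0 := hK.mulVec_ne_zero hΨ
  apply h0
  ext s
  have := congrFun heven s
  rw [Pi.neg_apply] at this
  exact self_eq_neg.mp this.symm

end Main

end ColumnAction

theorem permOp_one_mulVec {ι : Type} [LinearOrder ι] [Fintype ι] (ψ : State ι) :
    permOp (1 : Equiv.Perm ι) *ᵥ ψ = ψ := by
  rw [permOp_one, Matrix.one_mulVec]

/-! ### Reduction of the torus to a ring of columns, and the arithmetic of momenta. -/

section Torus

variable {d : ℕ} {L : Fin d → ℕ} {k : ℕ}

theorem Mode.mk_cell_flavor (m : Mode L k) : Mode.mk m.cell m.flavor = m := rfl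

theorem Mode.cell_mk (i : Cell L) (α : Fin k) : (Mode.mk i α).cell = i := rfl

theorem Mode.flavor_mk (i : Cell L) (α : Fin k) : (Mode.mk i α).flavor = α := rfl

/-- The permutations of the layers of cells perpendicular to the direction `x`. -/
def layerAction (L : Fin d → ℕ) (k : ℕ) (x : Fin d) : ColumnAction (Mode L k) (L x) where
  pos m := m.cell x
  perm :=
    { toFun := fun π =>
        { toFun := fun m => Mode.mk (Function.update m.cell x (π (m.cell x))) m.flavor
          invFun := fun m => Mode.mk (Function.update m.cell x (π.symm (m.cell x))) m.flavor
          left_inv := fun m => by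
            simp [Mode.cell_mk, Mode.flavor_mk, Mode.mk_cell_flavor]
          right_inv := fun m => by
            simp [Mode.cell_mk, Mode.flavor_mk, Mode.mk_cell_flavor] }
      map_one' := by
        ext m : 1
        simp [Mode.mk_cell_flavor]
      map_mul' := fun π ρ => by
        ext m : 1
        simp [Mode.cell_mk, Mode.flavor_mk] }
  pos_perm π m := by
    change Function.update m.cell x (π (m.cell x)) x = π (m.cell x)
    simp
  perm_congr π π' m h := by
    change Mode.mk (Function.update m.cell x (π (m.cell x))) m.flavor =
      Mode.mk (Function.update m.cell x (π' (m.cell x))) m.flavor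
    rw [h]

theorem translation_eq [∀ j, NeZero (L j)] (x : Fin d) :
    translation L k x = permOp ((layerAction L k x).perm (rot (L x))) := by
  unfold translation
  refine congrArg permOp ?_
  ext m : 1
  change Mode.mk (m.cell + Pi.single x 1) m.flavor =
    Mode.mk (Function.update m.cell x (m.cell x + 1)) m.flavor
  refine congrArg (fun i => Mode.mk i m.flavor) ?_
  ext j : 1
  by_cases hj : j = x
  · subst hj; simp
  · simp [hj]

/-- Only the extension of the gates in direction `x` is retained; the layers perpendicular to `x`
become columns. -/
theorem IsLayer.isLayerOn {r : ℕ} {A : Op (Mode L k)} (h : IsLayer r A) (x : Fin d) :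
    IsLayerOn (HasColumnRange (layerAction L k x).pos r) A := by
  obtain ⟨N, S, u, hS, hd, rfl⟩ := h
  refine ⟨List.ofFn fun a => ({m | m.cell ∈ S a}, u a), ?_, ?_, ?_⟩
  · intro g hg
    obtain ⟨a, rfl⟩ := List.mem_ofFn.mp hg
    obtain ⟨hr, hmem, hu, he⟩ := hS a
    refine ⟨fun m hm m' hm' => hr _ hm _ hm' x, hmem, ?_, ?_, he⟩
    · convert Matrix.mem_unitaryGroup_iff'.mp hu <;> rfl
    · convert Matrix.mem_unitaryGroup_iff.mp hu <;> rfl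
  · rw [List.pairwise_ofFn]
    intro a b hab
    rw [Set.disjoint_left]
    intro m hm hm'
    exact Finset.disjoint_left.mp (hd hab.ne) hm hm'
  · rw [List.map_ofFn]; convert rfl; rfl

theorem IsCircuit.isCircuitOn {r D : ℕ} {U : Op (Mode L k)} (h : IsCircuit r D U) (x : Fin d) :
    IsCircuitOn (HasColumnRange (layerAction L k x).pos r) D U := by
  obtain ⟨l, hl, hA, rfl⟩ := h
  induction D generalizing l with
  | zero =>
    rw [List.length_eq_zero_iff] at hl
    subst hl
    rw [List.prod_nil]
    change _ = _
    convert rfl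
  | succ D ih =>
    rcases l.eq_nil_or_concat with rfl | ⟨l, A, rfl⟩
    · simp at hl
    · refine ⟨l.prod, A, ih l (by simpa using hl) fun B hB => hA B (by simp [hB]),
        (hA A (by simp)).isLayerOn x, by simp⟩

theorem IsProductState.isPureOn_cell {φ : State (Mode L k)} (h : IsProductState φ) (hφ : φ ≠ 0)
    (i : Cell L) : IsPureOn {m : Mode L k | m.cell = i} φ := by
  classical
  obtain ⟨g, hg, hprod⟩ := h
  obtain ⟨p, hp⟩ : ∃ p : ℕ, ∀ A, g i A ≠ 0 → (-1 : ℂ) ^ A.card = (-1) ^ p := by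
    rcases hg i with h | h
    · exact ⟨0, fun A hA => by rw [(h A hA).neg_one_pow, pow_zero]⟩
    · exact ⟨1, fun A hA => by rw [(h A hA).neg_one_pow, pow_one]⟩
  set M : Finset (Mode L k) := Finset.univ.filter fun m => m.cell = i with hM
  have hMi : (M : Set (Mode L k)) = {m | m.cell = i} := by ext; simp [hM]
  have hmem : ∀ m, m ∈ M ↔ m.cell = i := fun m => by simp [hM]
  rw [← hMi]
  have hcard : ∀ B ⊆ M,
      (Finset.univ.filter fun α => Mode.mk i α ∈ B).card = B.card := by
    intro B hB
    refine Finset.card_bij (fun α _ => Mode.mk i α) (fun α hα => (Finset.mem_filter.mp hα).2)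
      (fun α _ β _ h => congrArg Mode.flavor h) (fun m hm => ⟨m.flavor, ?_, ?_⟩)
    · rw [Finset.mem_filter, ← (hmem m).mp (hB hm)]
      exact ⟨Finset.mem_univ _, hm⟩
    · rw [← (hmem m).mp (hB hm)]; rfl
  refine isPureOn_of_factor ?_ hφ (fun B => g i (Finset.univ.filter fun α => Mode.mk i α ∈ B))
    (fun B => ∏ j ∈ Finset.univ.erase i, g j (Finset.univ.filter fun α => Mode.mk j α ∈ B)) p ?_ ?_
  -- The lexicographic order compares cells first, so a mode of another cell lies on the same side
  -- of all modes of the cell `i`.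
  · intro j hj a ha b hb hlt
    rw [hmem] at hj ha hb
    change ¬ (ofLex (ofLex j).1) = i at hj
    have ha' : (ofLex a).1 = toLex i := ha
    have hb' : (ofLex b).1 = toLex i := hb
    rw [Prod.Lex.lt_iff] at hlt ⊢
    rw [ha'] at hlt
    rw [hb']
    rcases hlt with h | h
    · exact Or.inl h
    · exact absurd h.1 hj
  · intro B hB hne
    rw [← hcard B hB]
    exact hp _ hne
  · intro s
    rw [hprod, ← Finset.mul_prod_erase _ _ (Finset.mem_univ i)]
    congr 1
    · congr 2; ext α
      simp [hmem, Mode.cell_mk]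
    · refine Finset.prod_congr rfl fun j hj => ?_
      congr 2; ext α
      simp [hmem, Mode.cell_mk, Finset.ne_of_mem_erase hj]

theorem IsProductState.isPureOn {φ : State (Mode L k)} (h : IsProductState φ) (hφ : φ ≠ 0)
    (F : Finset (Cell L)) : IsPureOn {m : Mode L k | m.cell ∈ F} φ := by
  classical
  induction F using Finset.induction_on with
  | empty =>
    simp only [Finset.notMem_empty]
    exact isPureOn_empty φ
  | insert i F hi ih =>
    have e : {m : Mode L k | m.cell ∈ insert i F} = {m | m.cell = i} ∪ {m | m.cell ∈ F} := by
      ext m; simp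
    rw [e]
    refine (h.isPureOn_cell hφ i).union ?_ ih
    rw [Set.disjoint_left]
    rintro m rfl hm
    exact hi hm

theorem IsProductState.isPureOn_strip {φ : State (Mode L k)} (h : IsProductState φ) (hφ : φ ≠ 0)
    (x : Fin d) (s t : ℕ) : IsPureOn (strip (layerAction L k x).pos s t) φ := by
  have e : strip (layerAction L k x).pos s t =
      {m | m.cell ∈ Finset.univ.filter fun i : Cell L => s ≤ (i x).val ∧ (i x).val < t} := by
    ext m; simp [strip, layerAction]
  rw [e]
  exact h.isPureOn hφ _

theorem IsShortRangeEntangled.exists_circuitOn {r D : ℕ} {Ψ : State (Mode L k)} (hΨ : Ψ ≠ 0)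
    (h : IsShortRangeEntangled r D Ψ) (x : Fin d) : ∃ r' U, r' ≤ r' * D ∧ r' * D = r * D ∧
      IsCircuitOn (HasColumnRange (layerAction L k x).pos r') D U ∧
      ∀ s t, IsPureOn (strip (layerAction L k x).pos s t) (U *ᵥ Ψ) := by
  obtain ⟨U, hU, hφ⟩ := h
  have hU' := hU.isCircuitOn x
  have hp := hφ.isPureOn_strip (hU'.isLocalUnitary.mulVec_ne_zero hΨ) x
  rcases Nat.eq_zero_or_pos D with rfl | hD
  -- A circuit of depth 0 is the identity whatever the range, so the range can be lowered to 0 to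
  -- ensure `r' ≤ r' * D`.
  · exact ⟨0, U, by simp, by simp, hU', hp⟩
  · exact ⟨r, U, Nat.le_mul_of_pos_right r hD, rfl, hU', hp⟩

theorem eigenvalue_pow_eq_one [∀ j, NeZero (L j)] {x : Fin d} {Ψ : State (Mode L k)} {z : ℂ}
    (hΨ : Ψ ≠ 0) (hT : translation L k x *ᵥ Ψ = z • Ψ) : z ^ L x = 1 := by
  rw [translation_eq] at hT
  have h := ColumnAction.permOp_pow_mulVec hT (L x)
  rw [← map_pow, rot_pow_self, map_one, permOp_one_mulVec] at h
  have h' : (z ^ L x - 1) • Ψ = 0 := by rw [sub_smul, ← h, one_smul, sub_self]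
  exact sub_eq_zero.mp ((smul_eq_zero.mp h').resolve_right hΨ)

theorem IsShortRangeEntangled.eigenvalue [∀ j, NeZero (L j)] {x : Fin d} {r D : ℕ}
    (hL : 24 * (r * D) ≤ L x) {Ψ : State (Mode L k)} {z : ℂ} (hΨ : Ψ ≠ 0)
    (hT : translation L k x *ᵥ Ψ = z • Ψ) (h : IsShortRangeEntangled r D Ψ) :
    (Odd (L x) → z = 1) ∧ (Even (L x) → z = 1 ∨ z = -1) := by
  have hn := eigenvalue_pow_eq_one hΨ hT
  obtain ⟨r', U, hr, hrD, hU, hp⟩ := h.exists_circuitOn hΨ x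
  rw [← hrD] at hL
  rw [translation_eq] at hT
  have key : ∀ a b, a + b = L x → 9 * (r' * D) + 1 ≤ a → 9 * (r' * D) + 1 ≤ b →
      orderOf z ∣ 2 * (a * b) := fun a b hab ha hb => by
    rw [orderOf_dvd_iff_pow_eq_one, pow_mul]
    exact ColumnAction.pow_eq_one_of_circuit hΨ hT hU hr hp hab ha hb
  have hord : orderOf z ∣ L x := orderOf_dvd_of_pow_eq_one hn
  refine ⟨fun hodd => ?_, fun heven => ?_⟩
  · obtain ⟨m, hm⟩ := hodd
    rcases Nat.eq_zero_or_pos m with rfl | hmpos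
    · rw [hm] at hn; simpa using hn
    -- For n = 2m + 1 one has 4m(m + 1) = n² - 1, so the order of `z` divides two consecutive
    -- integers.
    have h1 := (key m (m + 1) (by omega) (by omega) (by omega)).mul_left 2
    have h2 := hord.mul_left (L x)
    have h3 : L x * L x = 2 * (2 * (m * (m + 1))) + 1 := by rw [hm]; ring
    rw [h3] at h2
    have h4 := (Nat.dvd_add_right h1).mp h2
    rwa [Nat.dvd_one, orderOf_eq_one_iff] at h4
  · obtain ⟨m, hm⟩ := heven
    have hz2 : z ^ 2 = 1 := by
      rcases Nat.lt_or_ge m 2 with hlt | hge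
      · have hpos := NeZero.pos (L x)
        obtain rfl : m = 1 := by omega
        rw [hm] at hn; exact hn
      -- For n = 2m, equal rings would only give the exponent 2m² = mn, which is no new information.
      -- With lengths m - 1 and m + 1 the order divides 2m² - 2 as well as 2m², hence 2.
      obtain ⟨c, rfl⟩ : ∃ c, m = c + 1 := ⟨m - 1, by omega⟩
      have h1 := key c (c + 2) (by omega) (by omega) (by omega)
      have h2 := hord.mul_left (c + 1)
      have h3 : (c + 1) * L x = 2 * (c * (c + 2)) + 2 := by rw [hm]; ring
      rw [h3] at h2
      rw [← orderOf_dvd_iff_pow_eq_one]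
      exact (Nat.dvd_add_right h1).mp h2
    exact mul_self_eq_one_iff.mp (by rw [← sq, hz2])

theorem IsShortRangeEntangled.parity_ne [∀ j, NeZero (L j)] {x : Fin d} {r D : ℕ}
    (hL : 24 * (r * D) ≤ L x) {Ψ : State (Mode L k)} {z : ℂ} (hΨ : Ψ ≠ 0)
    (hT : translation L k x *ᵥ Ψ = z • Ψ) (h : IsShortRangeEntangled r D Ψ)
    (heven : Even (L x)) : parity *ᵥ Ψ ≠ -Ψ := by
  obtain ⟨r', U, hr, hrD, hU, hp⟩ := h.exists_circuitOn hΨ x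
  rw [translation_eq] at hT
  obtain ⟨a, ha⟩ := heven
  exact ColumnAction.parity_of_circuit hΨ hT hU hr hp ha.symm (by omega)

end Torus

end LatticeFermion

end

open LatticeFermion in
theorem theorem2 :
    ∃ C : ℕ, ∀ (d : ℕ) (L : Fin d → ℕ) [∀ j, NeZero (L j)] (k : ℕ) (x : Fin d) (r D : ℕ),
      C * (r * D) ≤ L x →
      ∀ (Ψ : State (Mode L k)) (z : ℂ), Ψ ≠ 0 → translation L k x *ᵥ Ψ = z • Ψ →
        (IsShortRangeEntangled r D Ψ →
          (Odd (L x) → z = 1) ∧ (Even (L x) → z = 1 ∨ z = -1)) ∧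
        ((Odd (L x) ∧ z ≠ 1) ∨ (Even (L x) ∧ z ≠ 1 ∧ z ≠ -1) → IsLongRangeEntangled r D Ψ) ∧
        (Even (L x) → parity *ᵥ Ψ = -Ψ → IsLongRangeEntangled r D Ψ) := by
  -- With w = rD, the parity argument uses n / 2 ≥ 12w. For the momentum both rings need 9w + 1
  -- columns, and the shortest one used has n / 2 - 1 ≥ 12w - 1 columns, enough when w ≥ 1; for w =
  -- 0 only n = 1 and n = 2 need separate treatment.
  refine ⟨24, fun d L _ k x r D hL Ψ z hΨ hT => ⟨fun h => h.eigenvalue hL hΨ hT, ?_, ?_⟩⟩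
  · rintro hz hS
    obtain ⟨h1, h2⟩ := hS.eigenvalue hL hΨ hT
    rcases hz with ⟨ho, hz⟩ | ⟨he, hz, hz'⟩
    · exact hz (h1 ho)
    · exact (h2 he).elim hz hz'
  · intro he hp hS
    exact hS.parity_ne hL hΨ hT he hp
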